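/- Let $n\ge 1$ and let $\Bbbk$ be a field. All manifolds are smooth and oriented. An $n$-dimensional TQFT over $\Bbbk$ is a symmetric monoidal functor from the $n$-dimensional oriented cobordism category (objects: closed $(n-1)$-manifolds; morphisms: compact $n$-dimensional cobordisms up to orientation-preserving diffeomorphism compatible with the boundary diffeomorphisms; composition: gluing; monoidal structure: disjoint union) to $\Bbbk$-vector spaces. Let $\mathbf{nTQFT}^\times_{\Bbbk}$ be the group, under tensor product, of monoidal isomorphism classes of those TQFTs $\mathcal T$ for which there is a TQFT $\mathcal T'$ with $\mathcal T\otimes\mathcal T'$ isomorphic to the trivial TQFT. Let $\mathbb M_n$ be the commutative monoid, under disjoint union, of closed $n$-manifolds up to orientation-preserving diffeomorphism, and let $SKK_n$ be the quotient of its Grothendieck group by the subgroup generated by all elements $[M]-[N]-[M']+[N']$ with $$M=X_1\cup_f X_2,\quad N=X_1\cup_g X_2,\quad M'=Y_1\cup_f Y_2,\quad N'=Y_1\cup_g Y_2,$$ where $\Sigma$ is a closed $(n-1)$-manifold, $X_1,Y_1:\emptyset\rightsquigarrow\Sigma$ and $X_2,Y_2:\Sigma\rightsquigarrow\emptyset$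 are cobordisms, and $f,g:\Sigma\to\Sigma$ are orientation-preserving diffeomorphisms. Let $\delta:\operatorname{Hom}_{\Bbbk}(\Bbbk,\Bbbk)\to\Bbbk$ be the canonical isomorphism $\varphi\mapsto\varphi(1)$, and identify $\mathcal T(\emptyset)$ with $\Bbbk$ for each TQFT $\mathcal T$. Theorem. There is exactly one group homomorphism $$\Psi_n:\mathbf{nTQFT}^\times_{\Bbbk}\to\operatorname{Hom}(SKK_n,\Bbbk^\times)$$ with $\Psi_n(\mathcal T)([X])=\delta(\mathcal T(X))$ for every invertible TQFT $\mathcal T$ and every closed $n$-manifold $X$, regarded as a cobordism $\emptyset\rightsquigarrow\emptyset$. Let $\mathscr T^n_{\Bbbk}$ be the subgroup of $\mathbf{nTQFT}^\times_{\Bbbk}$ that consists of all $\mathcal T$ such that $\mathcal T(M)=\mathrm{id}$ for all $n$-cobordisms $M:\emptyset\rightsquigarrow\emptyset$, that is, for all $n$-cobordisms with empty boundary. Then $$\mathscr T^n_{\Bbbk}=\ker(\Psi_n).$$ -/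

import Mathlib

open scoped Manifold ContDiff TensorProduct Topology

universe u

namespace InvertibleTQFT

noncomputable section

/-! ### Compact oriented smooth manifolds -/

/-- The sign (`1`, `-1`, or `0` for a linearly dependent family) of a family of `n` vectors with
respect to an orientation; `someVector` is any alternating form representing the orientation. -/
def orientSign {V : Type*} [AddCommGroup V] [Module ℝ V] {n : ℕ}
    (o : Orientation ℝ V (Fin n)) (v : Fin n → V) : SignType :=
  SignType.sign (o.someVector v)

/-- Compact oriented smooth `n`-manifolds (not necessarily connected, possibly empty), modelled on
`I`. An orientation is a choice of orientation of each tangent space that is locally constant. Here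
`TangentSpace I y` is identified with `ℝⁿ` through the preferred chart at `y`, so that
`tangentCoordChange I y x y` expresses tangent vectors at `y` in the preferred chart at `x`. -/
structure CompactOriented {n : ℕ} {H : Type} [TopologicalSpace H]
    (I : ModelWithCorners ℝ (EuclideanSpace ℝ (Fin n)) H) where
  carrier : Type
  [topologicalSpace : TopologicalSpace carrier]
  [chartedSpace : ChartedSpace H carrier]
  [isManifold : IsManifold I ∞ carrier]
  [compactSpace : CompactSpace carrier]
  [t2Space : T2Space carrier]
  orient : ∀ x : carrier, Orientation ℝ (TangentSpace I x) (Fin n)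
  orient_locally_constant : ∀ x : carrier, ∀ᶠ y in 𝓝 x, ∀ v : Fin n → TangentSpace I y,
    orientSign (orient x) (fun i => tangentCoordChange I y x y (v i)) = orientSign (orient y) v

attribute [instance] CompactOriented.topologicalSpace CompactOriented.chartedSpace
  CompactOriented.isManifold CompactOriented.compactSpace CompactOriented.t2Space

instance {n : ℕ} {H : Type} [TopologicalSpace H]
    (I : ModelWithCorners ℝ (EuclideanSpace ℝ (Fin n)) H) :
    CoeSort (CompactOriented I) Type := ⟨CompactOriented.carrier⟩

section Manifolds

variable {n : ℕ} {H : Type} [TopologicalSpace H]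
  {I : ModelWithCorners ℝ (EuclideanSpace ℝ (Fin n)) H}

/-- Smooth maps (between manifolds of the same dimension) that preserve the orientation. In
particular the differential is invertible at each point. -/
def OrientationPreserving (M N : CompactOriented I) (f : M → N) : Prop :=
  ContMDiff I I ∞ f ∧ ∀ (x : M) (v : Fin n → TangentSpace I x),
    orientSign (N.orient (f x)) (fun i => mfderiv I I f x (v i)) = orientSign (M.orient x) v

/-- `M` and `N` are diffeomorphic through an orientation preserving diffeomorphism. -/
def OrientedDiffeomorphic (M N : CompactOriented I) : Prop :=
  ∃ f : Diffeomorph I I M N ∞, OrientationPreserving M N f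

/-- The empty manifold. -/
def CompactOriented.empty (I : ModelWithCorners ℝ (EuclideanSpace ℝ (Fin n)) H) :
    CompactOriented I :=
  letI : ChartedSpace H Empty := ChartedSpace.empty H Empty
  { carrier := Empty
    orient := fun x => x.elim
    orient_locally_constant := fun x => x.elim }

instance : IsEmpty (CompactOriented.empty I) := inferInstanceAs (IsEmpty Empty)

lemma tangentCoordChange_inl {M N : Type} [TopologicalSpace M] [ChartedSpace H M]
    [IsManifold I ∞ M] [TopologicalSpace N] [ChartedSpace H N] [IsManifold I ∞ N] (x y : M) :
    tangentCoordChange I (Sum.inl y : M ⊕ N) (Sum.inl x) (Sum.inl y) =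
      tangentCoordChange I y x y := by
  rw [tangentCoordChange_def, tangentCoordChange_def]
  have h1 : extChartAt I (Sum.inl x : M ⊕ N) ∘ (extChartAt I (Sum.inl y : M ⊕ N)).symm =
      extChartAt I x ∘ (extChartAt I y).symm := by
    funext z
    simp [extChartAt, ChartedSpace.sum_chartAt_inl, Sum.inl_injective.extend_apply]
  have h2 : extChartAt I (Sum.inl y : M ⊕ N) (Sum.inl y) = extChartAt I y y := by
    simp [extChartAt]
  rw [h1, h2]

lemma tangentCoordChange_inr {M N : Type} [TopologicalSpace M] [ChartedSpace H M]
    [IsManifold I ∞ M] [TopologicalSpace N] [ChartedSpace H N] [IsManifold I ∞ N] (x y : N) :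
    tangentCoordChange I (Sum.inr y : M ⊕ N) (Sum.inr x) (Sum.inr y) =
      tangentCoordChange I y x y := by
  rw [tangentCoordChange_def, tangentCoordChange_def]
  have h1 : extChartAt I (Sum.inr x : M ⊕ N) ∘ (extChartAt I (Sum.inr y : M ⊕ N)).symm =
      extChartAt I x ∘ (extChartAt I y).symm := by
    funext z
    simp [extChartAt, ChartedSpace.sum_chartAt_inr, Sum.inr_injective.extend_apply]
  have h2 : extChartAt I (Sum.inr y : M ⊕ N) (Sum.inr y) = extChartAt I y y := by
    simp [extChartAt]
  rw [h1, h2]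

/-- The disjoint union `M ⊔ N`. -/
def CompactOriented.sum (M N : CompactOriented I) : CompactOriented I where
  carrier := M ⊕ N
  orient p := match p with
    | .inl x => M.orient x
    | .inr y => N.orient y
  orient_locally_constant p := by
    rcases p with x | x
    · rw [(Topology.IsOpenEmbedding.inl (X := M) (Y := N)).map_nhds_eq x |>.symm,
        Filter.eventually_map]
      filter_upwards [M.orient_locally_constant x] with y hy v
      rw [tangentCoordChange_inl]
      exact hy v
    · rw [(Topology.IsOpenEmbedding.inr (X := M) (Y := N)).map_nhds_eq x |>.symm,
        Filter.eventually_map]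
      filter_upwards [N.orient_locally_constant x] with y hy v
      rw [tangentCoordChange_inr]
      exact hy v

/-! Orientation preserving maps: identity, composition, disjoint unions. -/

lemma OrientationPreserving.id (M : CompactOriented I) :
    OrientationPreserving M M (fun x => x) :=
  ⟨contMDiff_id, fun x v => by
    have : mfderiv I I (fun x : M => x) x = ContinuousLinearMap.id ℝ _ := mfderiv_id
    rw [this]; rfl⟩

lemma OrientationPreserving.comp {M N P : CompactOriented I} {g : N → P} {f : M → N}
    (hg : OrientationPreserving N P g) (hf : OrientationPreserving M N f) :
    OrientationPreserving M P (g ∘ f) :=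
  ⟨hg.1.comp hf.1, fun x v => by
    rw [mfderiv_comp x ((hg.1 _).mdifferentiableAt (by simp))
      ((hf.1 _).mdifferentiableAt (by simp))]
    exact (hg.2 (f x) _).trans (hf.2 x v)⟩

lemma OrientationPreserving.inl (M N : CompactOriented I) :
    OrientationPreserving M (M.sum N) Sum.inl :=
  ⟨ContMDiff.inl, fun x v => by
    have : mfderiv I I (Sum.inl : M → M ⊕ N) x = ContinuousLinearMap.id ℝ _ :=
      mfderiv_sumInl (p := (Sum.inl x : M ⊕ N))
    erw [this]; rfl⟩

lemma OrientationPreserving.inr (M N : CompactOriented I) :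
    OrientationPreserving N (M.sum N) Sum.inr :=
  ⟨ContMDiff.inr, fun x v => by
    have : mfderiv I I (Sum.inr : N → M ⊕ N) x = ContinuousLinearMap.id ℝ _ :=
      mfderiv_sumInr
    erw [this]; rfl⟩

lemma OrientationPreserving.of_sum {M N P : CompactOriented I} {f : M.sum N → P}
    (h : ContMDiff I I ∞ f)
    (h1 : OrientationPreserving M P (f ∘ Sum.inl)) (h2 : OrientationPreserving N P (f ∘ Sum.inr)) :
    OrientationPreserving (M.sum N) P f := by
  refine ⟨h, fun p v => ?_⟩
  rcases p with x | x
  · have e' := mfderiv_comp (g := f) (f := (Sum.inl : M → M.sum N)) x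
      ((h _).mdifferentiableAt (by simp))
      (((OrientationPreserving.inl M N).1 x).mdifferentiableAt (by simp))
    have e2 : mfderiv I I (Sum.inl : M → M ⊕ N) x = ContinuousLinearMap.id ℝ _ :=
      mfderiv_sumInl (p := (Sum.inl x : M ⊕ N))
    have e3 : mfderiv I I (f ∘ Sum.inl) x = mfderiv I I f (Sum.inl x) := by
      erw [e', e2]; rfl
    have e := h1.2 x v
    rw [e3] at e
    exact e
  · have e' := mfderiv_comp (g := f) (f := (Sum.inr : N → M.sum N)) x
      ((h _).mdifferentiableAt (by simp))
      (((OrientationPreserving.inr M N).1 x).mdifferentiableAt (by simp))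
    have e2 : mfderiv I I (Sum.inr : N → M ⊕ N) x = ContinuousLinearMap.id ℝ _ :=
      mfderiv_sumInr
    have e3 : mfderiv I I (f ∘ Sum.inr) x = mfderiv I I f (Sum.inr x) := by
      erw [e', e2]; rfl
    have e := h2.2 x v
    rw [e3] at e
    exact e

lemma OrientedDiffeomorphic.refl (M : CompactOriented I) : OrientedDiffeomorphic M M :=
  ⟨Diffeomorph.refl I M ∞, OrientationPreserving.id M⟩

lemma OrientedDiffeomorphic.trans {M N P : CompactOriented I} :
    OrientedDiffeomorphic M N → OrientedDiffeomorphic N P → OrientedDiffeomorphic M P :=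
  fun ⟨f, hf⟩ ⟨g, hg⟩ => ⟨f.trans g, hg.comp hf⟩

lemma OrientedDiffeomorphic.symm {M N : CompactOriented I} :
    OrientedDiffeomorphic M N → OrientedDiffeomorphic N M := by
  rintro ⟨f, hf⟩
  refine ⟨f.symm, f.symm.contMDiff, fun y v => ?_⟩
  have hd : (mfderiv I I f (f.symm y)).comp (mfderiv I I f.symm y) =
      ContinuousLinearMap.id ℝ (EuclideanSpace ℝ (Fin n)) := by
    have e := mfderiv_comp y ((f.contMDiff (f.symm y)).mdifferentiableAt (by simp))
      ((f.symm.contMDiff y).mdifferentiableAt (by simp))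
    have e2 : (f ∘ f.symm : N → N) = fun y => y := by funext z; simp
    rw [e2] at e
    exact e.symm.trans mfderiv_id
  have e := hf.2 (f.symm y) (fun i => mfderiv I I f.symm y (v i))
  have e3 : (fun i => mfderiv I I f (f.symm y) (mfderiv I I f.symm y (v i))) = v := by
    funext i
    exact congrArg (fun L => L (v i)) hd
  rw [← e]
  erw [e3]
  have key : ∀ z : N, z = y → ∀ w : Fin n → EuclideanSpace ℝ (Fin n),
      orientSign (V := EuclideanSpace ℝ (Fin n)) (N.orient z) w =
      orientSign (V := EuclideanSpace ℝ (Fin n)) (N.orient y) w := by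
    rintro z rfl w; rfl
  exact key _ (f.apply_symm_apply y) v

lemma OrientedDiffeomorphic.sum_congr {M M' N N' : CompactOriented I} :
    OrientedDiffeomorphic M M' → OrientedDiffeomorphic N N' →
      OrientedDiffeomorphic (M.sum N) (M'.sum N') :=
  fun ⟨f, hf⟩ ⟨g, hg⟩ => ⟨f.sumCongr g, .of_sum (f.sumCongr g).contMDiff
    ((OrientationPreserving.inl M' N').comp hf) ((OrientationPreserving.inr M' N').comp hg)⟩

lemma OrientedDiffeomorphic.sum_comm (M N : CompactOriented I) :
    OrientedDiffeomorphic (M.sum N) (N.sum M) :=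
  ⟨Diffeomorph.sumComm I M ∞ N, .of_sum (Diffeomorph.sumComm I M ∞ N).contMDiff
    (OrientationPreserving.inr N M) (OrientationPreserving.inl N M)⟩

lemma OrientedDiffeomorphic.sum_assoc (M N P : CompactOriented I) :
    OrientedDiffeomorphic ((M.sum N).sum P) (M.sum (N.sum P)) := by
  refine ⟨Diffeomorph.sumAssoc I M ∞ N P, .of_sum (Diffeomorph.sumAssoc I M ∞ N P).contMDiff
    (.of_sum ?_ (.inl M (N.sum P)) ((OrientationPreserving.inr M (N.sum P)).comp (.inl N P)))
    ((OrientationPreserving.inr M (N.sum P)).comp (.inr N P))⟩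
  exact (Diffeomorph.sumAssoc I M ∞ N P).contMDiff.comp (ContMDiff.inl (M := M.sum N) (M' := P))

lemma OrientedDiffeomorphic.sum_empty (M : CompactOriented I) :
    OrientedDiffeomorphic (M.sum (.empty I)) M :=
  ⟨Diffeomorph.sumEmpty I M (M' := CompactOriented.empty I) ∞,
    .of_sum (Diffeomorph.sumEmpty I M (M' := CompactOriented.empty I) ∞).contMDiff
      (OrientationPreserving.id M)
      ⟨fun x => isEmptyElim x, fun x => isEmptyElim x⟩⟩

end Manifolds
/-! ### Cobordisms -/

/-- Closed oriented smooth `d`-manifolds. -/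
abbrev ClosedManifold (d : ℕ) := CompactOriented (𝓡 d)

/-- Compact oriented smooth `(d+1)`-manifolds with boundary. -/
abbrev ManifoldWithBoundary (d : ℕ) := CompactOriented (𝓡∂ (d + 1))

section Cobordisms

variable {d : ℕ}

/-- The tangent vector `v` at the boundary point `p` points into the manifold: in the preferred
chart at `p`, with values in the half-space `{x | 0 ≤ x 0}`, its coordinate `v 0` is positive. -/
def IsInward {W : ManifoldWithBoundary d} (p : W) (v : TangentSpace (𝓡∂ (d + 1)) p) : Prop :=
  0 < (show EuclideanSpace ℝ (Fin (d + 1)) from v) 0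

/-- The tangent vector `v` at the boundary point `p` points out of the manifold. -/
def IsOutward {W : ManifoldWithBoundary d} (p : W) (v : TangentSpace (𝓡∂ (d + 1)) p) : Prop :=
  (show EuclideanSpace ℝ (Fin (d + 1)) from v) 0 < 0

/-- An oriented cobordism `S ⇝ T` between closed `d`-manifolds: a compact oriented manifold with
boundary `bulk` whose boundary is the disjoint union of the in-boundary `range inMap` and the
out-boundary `range outMap`, with diffeomorphisms `inMap` and `outMap` from `S` and `T` onto these.
The boundary carries the orientation "outward vector first"; `outMap` preserves it and `inMap`
reverses it. (The orientation conditions make the differentials of the two maps injective.) -/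
structure Cobordism (S T : ClosedManifold d) where
  bulk : ManifoldWithBoundary d
  inMap : S → bulk
  outMap : T → bulk
  contMDiff_inMap : ContMDiff (𝓡 d) (𝓡∂ (d + 1)) ∞ inMap
  contMDiff_outMap : ContMDiff (𝓡 d) (𝓡∂ (d + 1)) ∞ outMap
  injective_inMap : Function.Injective inMap
  injective_outMap : Function.Injective outMap
  inMap_ne_outMap : ∀ x y, inMap x ≠ outMap y
  boundary_eq : (𝓡∂ (d + 1)).boundary bulk = Set.range inMap ∪ Set.range outMap
  orient_inMap : ∀ (x : S) (v : TangentSpace (𝓡∂ (d + 1)) (inMap x))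
    (w : Fin d → TangentSpace (𝓡 d) x), IsInward (inMap x) v →
      orientSign (bulk.orient (inMap x))
        (Matrix.vecCons v (fun i => mfderiv (𝓡 d) (𝓡∂ (d + 1)) inMap x (w i))) =
      orientSign (S.orient x) w
  orient_outMap : ∀ (x : T) (v : TangentSpace (𝓡∂ (d + 1)) (outMap x))
    (w : Fin d → TangentSpace (𝓡 d) x), IsOutward (outMap x) v →
      orientSign (bulk.orient (outMap x))
        (Matrix.vecCons v (fun i => mfderiv (𝓡 d) (𝓡∂ (d + 1)) outMap x (w i))) =
      orientSign (T.orient x) w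

/-- Equivalence of cobordisms: an orientation preserving diffeomorphism that is compatible with the
boundary diffeomorphisms. -/
def Cobordism.Equivalent {S T : ClosedManifold d} (M N : Cobordism S T) : Prop :=
  ∃ f : Diffeomorph (𝓡∂ (d + 1)) (𝓡∂ (d + 1)) M.bulk N.bulk ∞,
    OrientationPreserving M.bulk N.bulk f ∧
    (∀ x, f (M.inMap x) = N.inMap x) ∧ (∀ x, f (M.outMap x) = N.outMap x)

/-- `C` is a mapping cylinder of `f : S → T` (for `f = id`: a cylinder `S × [0,1]`): up to a
diffeomorphism it is `S × [0,1]`, with in-boundary diffeomorphism `x ↦ (x, 0)` and out-boundary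
diffeomorphism `f x ↦ (x, 1)`. -/
def Cobordism.IsMappingCylinder {S T : ClosedManifold d} (f : S → T) (C : Cobordism S T) : Prop :=
  ∃ Φ : Diffeomorph ((𝓡 d).prod (𝓡∂ 1)) (𝓡∂ (d + 1)) (S × Set.Icc (0 : ℝ) 1) C.bulk ∞,
    (∀ x, Φ (x, 0) = C.inMap x) ∧ (∀ x, Φ (x, 1) = C.outMap (f x))

/-- `c : S × [0,∞) → W` is a collar of the part `range φ` of the boundary of `W`: a diffeomorphism
onto an open subset with `c (x, 0) = φ x`. (`EuclideanHalfSpace 1` is `[0,∞)`.) -/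
def IsCollar {S : ClosedManifold d} {W : ManifoldWithBoundary d} (φ : S → W)
    (c : S × EuclideanHalfSpace 1 → W) : Prop :=
  IsLocalDiffeomorph ((𝓡 d).prod (𝓡∂ 1)) (𝓡∂ (d + 1)) ∞ c ∧ Function.Injective c ∧
    ∀ x, c (x, 0) = φ x

/-- `W` is obtained by gluing `M` and `N` along the diffeomorphism `f` from (the manifold `T` that
parametrizes) the out-boundary of `M` to (the manifold `T'` that parametrizes) the in-boundary of
`N`. That is, `W = M ∪ N` with the out-boundary point of `M` given by `x` identified with the
in-boundary point of `N` given by `f x` and with no other identification, and the smooth structure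
of `W` is the one obtained from a choice of collars of the two boundaries: these collars fit
together to a smooth bicollar `T × ℝ → W`. For `f = id` this is the composition `M N` of cobordisms
`M : S ⇝ T` and `N : T ⇝ U`. -/
def Cobordism.IsGluing {S T T' U : ClosedManifold d} (M : Cobordism S T) (f : T → T')
    (N : Cobordism T' U) (W : Cobordism S U) : Prop :=
  ∃ (i : M.bulk → W.bulk) (j : N.bulk → W.bulk),
    OrientationPreserving M.bulk W.bulk i ∧ OrientationPreserving N.bulk W.bulk j ∧
    Function.Injective i ∧ Function.Injective j ∧
    Set.range i ∪ Set.range j = Set.univ ∧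
    (∀ p q, i p = j q ↔ ∃ x, p = M.outMap x ∧ q = N.inMap (f x)) ∧
    (∀ x, i (M.inMap x) = W.inMap x) ∧ (∀ x, j (N.outMap x) = W.outMap x) ∧
    ∃ (c : T × EuclideanHalfSpace 1 → M.bulk) (c' : T × EuclideanHalfSpace 1 → N.bulk)
      (b : T × ℝ → W.bulk),
      IsCollar M.outMap c ∧ IsCollar (fun x => N.inMap (f x)) c' ∧
      IsLocalDiffeomorph ((𝓡 d).prod 𝓘(ℝ, ℝ)) (𝓡∂ (d + 1)) ∞ b ∧
      ∀ (x : T) (t : EuclideanHalfSpace 1),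
        b (x, -(t.val 0)) = i (c (x, t)) ∧ b (x, t.val 0) = j (c' (x, t))

section

variable {A B C D : Type} [TopologicalSpace A] [TopologicalSpace B] [TopologicalSpace C]
  [TopologicalSpace D] [ChartedSpace (EuclideanSpace ℝ (Fin d)) A]
  [ChartedSpace (EuclideanSpace ℝ (Fin d)) B] [ChartedSpace (EuclideanHalfSpace (d + 1)) C]
  [ChartedSpace (EuclideanHalfSpace (d + 1)) D]

lemma mfderiv_sumMap_inl {f : A → C} {g : B → D} (hf : ContMDiff (𝓡 d) (𝓡∂ (d + 1)) ∞ f)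
    (hg : ContMDiff (𝓡 d) (𝓡∂ (d + 1)) ∞ g) (x : A) :
    mfderiv (𝓡 d) (𝓡∂ (d + 1)) (Sum.map f g) (Sum.inl x) = mfderiv (𝓡 d) (𝓡∂ (d + 1)) f x := by
  have e := mfderiv_comp (g := Sum.map f g) (f := (Sum.inl : A → A ⊕ B)) x
    ((hf.sumMap hg _).mdifferentiableAt (by simp))
    ((ContMDiff.inl (n := ∞) (I := 𝓡 d) x).mdifferentiableAt (by simp))
  have e' := mfderiv_comp (g := (Sum.inl : C → C ⊕ D)) (f := f) x
    ((ContMDiff.inl (n := ∞) (I := 𝓡∂ (d + 1)) _).mdifferentiableAt (by simp))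
    ((hf _).mdifferentiableAt (by simp))
  have e2 : mfderiv (𝓡 d) (𝓡 d) (Sum.inl : A → A ⊕ B) x = ContinuousLinearMap.id ℝ _ :=
    mfderiv_sumInl (p := (Sum.inl x : A ⊕ B))
  have e3 : mfderiv (𝓡∂ (d + 1)) (𝓡∂ (d + 1)) (Sum.inl : C → C ⊕ D) (f x) =
      ContinuousLinearMap.id ℝ _ := mfderiv_sumInl (p := (Sum.inl (f x) : C ⊕ D))
  rw [e2] at e
  rw [e3] at e'
  exact e.symm.trans e'

lemma mfderiv_sumMap_inr {f : A → C} {g : B → D} (hf : ContMDiff (𝓡 d) (𝓡∂ (d + 1)) ∞ f)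
    (hg : ContMDiff (𝓡 d) (𝓡∂ (d + 1)) ∞ g) (x : B) :
    mfderiv (𝓡 d) (𝓡∂ (d + 1)) (Sum.map f g) (Sum.inr x) = mfderiv (𝓡 d) (𝓡∂ (d + 1)) g x := by
  have e := mfderiv_comp (g := Sum.map f g) (f := (Sum.inr : B → A ⊕ B)) x
    ((hf.sumMap hg _).mdifferentiableAt (by simp))
    ((ContMDiff.inr (n := ∞) (I := 𝓡 d) x).mdifferentiableAt (by simp))
  have e' := mfderiv_comp (g := (Sum.inr : D → C ⊕ D)) (f := g) x
    ((ContMDiff.inr (n := ∞) (I := 𝓡∂ (d + 1)) _).mdifferentiableAt (by simp))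
    ((hg _).mdifferentiableAt (by simp))
  have e2 : mfderiv (𝓡 d) (𝓡 d) (Sum.inr : B → A ⊕ B) x = ContinuousLinearMap.id ℝ _ :=
    mfderiv_sumInr
  have e3 : mfderiv (𝓡∂ (d + 1)) (𝓡∂ (d + 1)) (Sum.inr : D → C ⊕ D) (g x) =
      ContinuousLinearMap.id ℝ _ := mfderiv_sumInr
  rw [e2] at e
  rw [e3] at e'
  exact e.symm.trans e'

end

/-- The disjoint union of cobordisms. -/
def Cobordism.sum {S S' T T' : ClosedManifold d} (M : Cobordism S T) (N : Cobordism S' T') :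
    Cobordism (S.sum S') (T.sum T') where
  bulk := M.bulk.sum N.bulk
  inMap := Sum.map M.inMap N.inMap
  outMap := Sum.map M.outMap N.outMap
  contMDiff_inMap := M.contMDiff_inMap.sumMap N.contMDiff_inMap
  contMDiff_outMap := M.contMDiff_outMap.sumMap N.contMDiff_outMap
  injective_inMap := Sum.map_injective.2 ⟨M.injective_inMap, N.injective_inMap⟩
  injective_outMap := Sum.map_injective.2 ⟨M.injective_outMap, N.injective_outMap⟩
  inMap_ne_outMap := by
    rintro (x | x) (y | y) h
    · exact M.inMap_ne_outMap x y (Sum.inl_injective h)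
    · exact Sum.inl_ne_inr h
    · exact Sum.inr_ne_inl h
    · exact N.inMap_ne_outMap x y (Sum.inr_injective h)
  boundary_eq := by
    have h := ModelWithCorners.boundary_disjointUnion (I := 𝓡∂ (d + 1)) (M := M.bulk)
      (M' := N.bulk)
    refine h.trans ?_
    rw [M.boundary_eq, N.boundary_eq]
    ext p
    change p ∈ Sum.inl '' (_ ∪ _) ∪ Sum.inr '' (_ ∪ _) ↔
      (∃ x, Sum.map M.inMap N.inMap x = p) ∨ (∃ x, Sum.map M.outMap N.outMap x = p)
    rcases p with p | p <;> simp
  orient_inMap := by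
    rintro (x | x) v w hv
    · erw [mfderiv_sumMap_inl M.contMDiff_inMap N.contMDiff_inMap x]
      exact M.orient_inMap x v w hv
    · erw [mfderiv_sumMap_inr M.contMDiff_inMap N.contMDiff_inMap x]
      exact N.orient_inMap x v w hv
  orient_outMap := by
    rintro (x | x) v w hv
    · erw [mfderiv_sumMap_inl M.contMDiff_outMap N.contMDiff_outMap x]
      exact M.orient_outMap x v w hv
    · erw [mfderiv_sumMap_inr M.contMDiff_outMap N.contMDiff_outMap x]
      exact N.orient_outMap x v w hv

end Cobordisms

/-! ### The group `SKK_n`, where `n = d + 1` -/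

section SKK

variable (d : ℕ)

/-- Closed oriented `(d+1)`-manifolds, as compact manifolds with empty boundary. -/
def ClosedBulk := {X : ManifoldWithBoundary d // (𝓡∂ (d + 1)).boundary X = ∅}

variable {d}

/-- A closed `(d+1)`-manifold as a cobordism from the empty manifold to itself. -/
def ClosedBulk.toCobordism (X : ClosedBulk d) :
    Cobordism (CompactOriented.empty (𝓡 d)) (CompactOriented.empty (𝓡 d)) where
  bulk := X.1
  inMap := isEmptyElim
  outMap := isEmptyElim
  contMDiff_inMap x := isEmptyElim x
  contMDiff_outMap x := isEmptyElim x
  injective_inMap x := isEmptyElim x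
  injective_outMap x := isEmptyElim x
  inMap_ne_outMap x := isEmptyElim x
  boundary_eq := by rw [X.2, Set.range_eq_empty, Set.union_empty]
  orient_inMap x := isEmptyElim x
  orient_outMap x := isEmptyElim x

/-- The disjoint union of closed manifolds. -/
def ClosedBulk.sum (X Y : ClosedBulk d) : ClosedBulk d :=
  ⟨X.1.sum Y.1, by
    refine (ModelWithCorners.boundary_disjointUnion (I := 𝓡∂ (d + 1)) (M := X.1)
      (M' := Y.1)).trans ?_
    rw [X.2, Y.2, Set.image_empty, Set.image_empty, Set.union_empty]
    rfl⟩

/-- The empty closed manifold. -/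
def ClosedBulk.empty : ClosedBulk d :=
  ⟨.empty (𝓡∂ (d + 1)), Set.eq_empty_of_isEmpty _⟩

variable (d)

instance ClosedBulk.setoid : Setoid (ClosedBulk d) where
  r X Y := OrientedDiffeomorphic X.1 Y.1
  iseqv := ⟨fun X => .refl X.1, .symm, .trans⟩

/-- The set `𝕄_n`, `n = d + 1`, of closed oriented `n`-manifolds up to orientation preserving
diffeomorphism. -/
def ManifoldClass := Quotient (ClosedBulk.setoid d)

instance : Zero (ManifoldClass d) := ⟨Quotient.mk _ .empty⟩

instance : Add (ManifoldClass d) :=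
  ⟨Quotient.map₂ ClosedBulk.sum fun _ _ h _ _ h' => OrientedDiffeomorphic.sum_congr h h'⟩

/-- `𝕄_n` is a commutative monoid under disjoint union. -/
instance : AddCommMonoid (ManifoldClass d) where
  add_assoc := by
    rintro ⟨X⟩ ⟨Y⟩ ⟨Z⟩
    exact Quotient.sound (OrientedDiffeomorphic.sum_assoc X.1 Y.1 Z.1)
  add_comm := by
    rintro ⟨X⟩ ⟨Y⟩
    exact Quotient.sound (OrientedDiffeomorphic.sum_comm X.1 Y.1)
  add_zero := by
    rintro ⟨X⟩
    exact Quotient.sound (OrientedDiffeomorphic.sum_empty X.1)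
  zero_add := by
    rintro ⟨X⟩
    exact Quotient.sound ((OrientedDiffeomorphic.sum_comm _ X.1).trans
      (OrientedDiffeomorphic.sum_empty X.1))
  nsmul := nsmulRec

variable {d}

/-- The class of `X` in the Grothendieck group of `𝕄_n`. -/
def ClosedBulk.toGrothendieck (X : ClosedBulk d) : Algebra.GrothendieckAddGroup (ManifoldClass d) :=
  Algebra.GrothendieckAddGroup.of (Quotient.mk (ClosedBulk.setoid d) X : ManifoldClass d)

/-- `X = X₁ ∪_f X₂` for a diffeomorphism `f : S → S` of the common boundary of `X₁` and `X₂`. -/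
def IsClosedGluing {S : ClosedManifold d} (X₁ : Cobordism (.empty (𝓡 d)) S) (f : S → S)
    (X₂ : Cobordism S (.empty (𝓡 d))) (X : ClosedBulk d) : Prop :=
  Cobordism.IsGluing X₁ f X₂ X.toCobordism

variable (d)

/-- The subgroup `R_n^SKK` generated by the elements `[M] - [N] - [M'] + [N']` for which
`M = X₁ ∪_f X₂`, `N = X₁ ∪_g X₂`, `M' = Y₁ ∪_f Y₂`, `N' = Y₁ ∪_g Y₂` with the same orientation
preserving gluing diffeomorphisms `f, g : S → S`. -/
def relationsSKK : AddSubgroup (Algebra.GrothendieckAddGroup (ManifoldClass d)) :=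
  AddSubgroup.closure {z | ∃ (S : ClosedManifold d) (X₁ Y₁ : Cobordism (.empty (𝓡 d)) S)
    (X₂ Y₂ : Cobordism S (.empty (𝓡 d))) (f g : Diffeomorph (𝓡 d) (𝓡 d) S S ∞)
    (M N M' N' : ClosedBulk d),
    OrientationPreserving S S f ∧ OrientationPreserving S S g ∧
    IsClosedGluing X₁ f X₂ M ∧ IsClosedGluing X₁ g X₂ N ∧
    IsClosedGluing Y₁ f Y₂ M' ∧ IsClosedGluing Y₁ g Y₂ N' ∧
    z = M.toGrothendieck - N.toGrothendieck - M'.toGrothendieck + N'.toGrothendieck}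

/-- The group `SKK_n`, `n = d + 1`. -/
abbrev SKK := Algebra.GrothendieckAddGroup (ManifoldClass d) ⧸ relationsSKK d

variable {d}

/-- The class `[X]_SKK`. -/
def ClosedBulk.toSKK (X : ClosedBulk d) : SKK d := QuotientAddGroup.mk X.toGrothendieck

end SKK

/-! ### Topological quantum field theories -/

section TQFT

/-- An `n`-dimensional oriented TQFT over `k`, `n = d + 1`: a symmetric monoidal functor from
`n`-cobordisms to vector spaces. -/
structure TQFT (k : Type u) [Field k] (d : ℕ) where
  obj : ClosedManifold d → Type u
  [addCommGroup : ∀ S, AddCommGroup (obj S)]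
  [module : ∀ S, Module k (obj S)]
  map : ∀ {S T : ClosedManifold d}, Cobordism S T → (obj S →ₗ[k] obj T)
  map_equivalent : ∀ {S T : ClosedManifold d} (M N : Cobordism S T),
    M.Equivalent N → map M = map N
  map_gluing : ∀ {S T U : ClosedManifold d} (M : Cobordism S T) (N : Cobordism T U)
    (W : Cobordism S U), M.IsGluing (fun x => x) N W → map W = map N ∘ₗ map M
  map_cylinder : ∀ {S : ClosedManifold d} (C : Cobordism S S),
    C.IsMappingCylinder (fun x => x) → map C = LinearMap.id
  /-- the isomorphism of the value of the empty manifold with `k` -/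
  unit : k ≃ₗ[k] obj (.empty (𝓡 d))
  /-- the isomorphisms of the value of a disjoint union with the tensor product -/
  tensor : ∀ S T : ClosedManifold d, obj S ⊗[k] obj T ≃ₗ[k] obj (S.sum T)
  map_sum : ∀ {S S' T T' : ClosedManifold d} (M : Cobordism S T) (N : Cobordism S' T')
    (a : obj S) (b : obj S'),
    map (M.sum N) (tensor S S' (a ⊗ₜ b)) = tensor T T' (map M a ⊗ₜ map N b)
  /-- compatibility with `(S ⊔ T) ⊔ U = S ⊔ (T ⊔ U)`; `C` is the cobordism of this identification -/
  tensor_assoc : ∀ {S T U : ClosedManifold d}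
    (C : Cobordism ((S.sum T).sum U) (S.sum (T.sum U))),
    C.IsMappingCylinder (Equiv.sumAssoc S T U) → ∀ (a : obj S) (b : obj T) (c : obj U),
    map C (tensor _ _ (tensor _ _ (a ⊗ₜ b) ⊗ₜ c)) = tensor _ _ (a ⊗ₜ tensor _ _ (b ⊗ₜ c))
  /-- compatibility with `∅ ⊔ S = S` -/
  unit_tensor : ∀ {S : ClosedManifold d} (C : Cobordism ((CompactOriented.empty (𝓡 d)).sum S) S),
    C.IsMappingCylinder (Equiv.emptySum (CompactOriented.empty (𝓡 d)) S) → ∀ a : obj S,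
    map C (tensor _ _ (unit 1 ⊗ₜ a)) = a
  /-- compatibility with `S ⊔ ∅ = S` -/
  tensor_unit : ∀ {S : ClosedManifold d} (C : Cobordism (S.sum (.empty (𝓡 d))) S),
    C.IsMappingCylinder (Equiv.sumEmpty S (CompactOriented.empty (𝓡 d))) → ∀ a : obj S,
    map C (tensor _ _ (a ⊗ₜ unit 1)) = a
  /-- compatibility with `S ⊔ T = T ⊔ S` -/
  tensor_comm : ∀ {S T : ClosedManifold d} (C : Cobordism (S.sum T) (T.sum S)),
    C.IsMappingCylinder (Equiv.sumComm S T) → ∀ (a : obj S) (b : obj T),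
    map C (tensor _ _ (a ⊗ₜ b)) = tensor _ _ (b ⊗ₜ a)

attribute [instance] TQFT.addCommGroup TQFT.module

variable {k : Type u} [Field k] {d : ℕ}

/-- Isomorphisms of TQFTs: monoidal natural isomorphisms. -/
structure TQFT.Iso (F G : TQFT k d) where
  app : ∀ S : ClosedManifold d, F.obj S ≃ₗ[k] G.obj S
  naturality : ∀ {S T : ClosedManifold d} (M : Cobordism S T) (a : F.obj S),
    app T (F.map M a) = G.map M (app S a)
  app_unit : app _ (F.unit 1) = G.unit 1
  app_tensor : ∀ {S T : ClosedManifold d} (a : F.obj S) (b : F.obj T),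
    app _ (F.tensor S T (a ⊗ₜ b)) = G.tensor S T (app S a ⊗ₜ app T b)

/-- The inverse isomorphism. -/
def TQFT.Iso.symm {F G : TQFT k d} (e : F.Iso G) : G.Iso F where
  app S := (e.app S).symm
  naturality M a := by
    rw [LinearEquiv.symm_apply_eq, e.naturality, LinearEquiv.apply_symm_apply]
  app_unit := by rw [LinearEquiv.symm_apply_eq, e.app_unit]
  app_tensor a b := by
    rw [LinearEquiv.symm_apply_eq, e.app_tensor, LinearEquiv.apply_symm_apply,
      LinearEquiv.apply_symm_apply]

/-- Composition of isomorphisms. -/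
def TQFT.Iso.trans {F G K : TQFT k d} (e : F.Iso G) (e' : G.Iso K) : F.Iso K where
  app S := (e.app S).trans (e'.app S)
  naturality M a := by simp [e.naturality, e'.naturality]
  app_unit := by simp [e.app_unit, e'.app_unit]
  app_tensor a b := by simp [e.app_tensor, e'.app_tensor]

instance TQFT.setoid : Setoid (TQFT k d) where
  r F G := Nonempty (F.Iso G)
  iseqv :=
    { refl := fun _ => ⟨⟨fun _ => .refl k _, fun _ _ => rfl, rfl, fun _ _ => rfl⟩⟩
      symm := fun ⟨e⟩ => ⟨e.symm⟩
      trans := fun ⟨e⟩ ⟨e'⟩ => ⟨e.trans e'⟩ }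

/-- The trivial TQFT. -/
def TQFT.trivial (k : Type u) [Field k] (d : ℕ) : TQFT k d where
  obj _ := k
  map _ := LinearMap.id
  map_equivalent _ _ _ := rfl
  map_gluing _ _ _ _ := rfl
  map_cylinder _ _ := rfl
  unit := .refl k k
  tensor _ _ := TensorProduct.lid k k
  map_sum _ _ _ _ := rfl
  tensor_assoc _ _ _ _ _ := by simp [mul_assoc]
  unit_tensor _ _ _ := by simp
  tensor_unit _ _ _ := by simp
  tensor_comm _ _ _ _ := by simp [mul_comm]

/-- The product of two TQFTs. -/
def TQFT.mul (F G : TQFT k d) : TQFT k d where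
  obj S := F.obj S ⊗[k] G.obj S
  map M := TensorProduct.map (F.map M) (G.map M)
  map_equivalent M N h := by rw [F.map_equivalent M N h, G.map_equivalent M N h]
  map_gluing M N W h := by
    rw [F.map_gluing M N W h, G.map_gluing M N W h, TensorProduct.map_comp]
  map_cylinder C h := by rw [F.map_cylinder C h, G.map_cylinder C h, TensorProduct.map_id]
  unit := (TensorProduct.lid k k).symm.trans (TensorProduct.congr F.unit G.unit)
  tensor S T := (TensorProduct.tensorTensorTensorComm k (F.obj S) (G.obj S) (F.obj T)
    (G.obj T)).trans (TensorProduct.congr (F.tensor S T) (G.tensor S T))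
  map_sum M N a b := by
    induction a with
    | zero => simp
    | add a a' h h' => simp only [TensorProduct.add_tmul, map_add, h, h']
    | tmul a a' =>
      induction b with
      | zero => simp
      | add b b' h h' => simp only [TensorProduct.tmul_add, map_add, h, h']
      | tmul b b' => simp [F.map_sum, G.map_sum]
  tensor_assoc C h a b c := by
    induction a with
    | zero => simp
    | add a a' h h' => simp only [TensorProduct.add_tmul, map_add, h, h']
    | tmul a a' =>
      induction b with
      | zero => simp
      | add b b' h h' => simp only [TensorProduct.add_tmul, TensorProduct.tmul_add, map_add, h, h']
      | tmul b b' =>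
        induction c with
        | zero => simp
        | add c c' h h' => simp only [TensorProduct.tmul_add, map_add, h, h']
        | tmul c c' => simp [F.tensor_assoc C h, G.tensor_assoc C h]
  unit_tensor C h a := by
    induction a with
    | zero => simp
    | add a a' h h' => simp only [TensorProduct.tmul_add, map_add, h, h']
    | tmul a a' => simp [F.unit_tensor C h, G.unit_tensor C h]
  tensor_unit C h a := by
    induction a with
    | zero => simp
    | add a a' h h' => simp only [TensorProduct.add_tmul, map_add, h, h']
    | tmul a a' => simp [F.tensor_unit C h, G.tensor_unit C h]
  tensor_comm C h a b := by
    induction a with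
    | zero => simp
    | add a a' h h' => simp only [TensorProduct.add_tmul, TensorProduct.tmul_add, map_add, h, h']
    | tmul a a' =>
      induction b with
      | zero => simp
      | add b b' h h' => simp only [TensorProduct.add_tmul, TensorProduct.tmul_add, map_add, h, h']
      | tmul b b' => simp [F.tensor_comm C h, G.tensor_comm C h]

variable (k d) in
/-- The TQFTs up to isomorphism. -/
def TQFTClass := Quotient (TQFT.setoid (k := k) (d := d))

/-- The isomorphism class of a TQFT. -/
def TQFT.toClass (F : TQFT k d) : TQFTClass k d := Quotient.mk _ F

/-- An isomorphism from a product of TQFTs is determined by its values on pure tensors. -/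
def TQFT.Iso.ofMul {F G K : TQFT k d} (e : ∀ S, F.obj S ⊗[k] G.obj S ≃ₗ[k] K.obj S)
    (h₁ : ∀ {S T : ClosedManifold d} (M : Cobordism S T) (a : F.obj S) (b : G.obj S),
      e T (F.map M a ⊗ₜ G.map M b) = K.map M (e S (a ⊗ₜ b)))
    (h₂ : e _ (F.unit 1 ⊗ₜ G.unit 1) = K.unit 1)
    (h₃ : ∀ {S T : ClosedManifold d} (a : F.obj S) (b : G.obj S) (a' : F.obj T) (b' : G.obj T),
      e _ (F.tensor S T (a ⊗ₜ a') ⊗ₜ G.tensor S T (b ⊗ₜ b')) =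
        K.tensor S T (e S (a ⊗ₜ b) ⊗ₜ e T (a' ⊗ₜ b'))) : (F.mul G).Iso K where
  app := e
  naturality {S T} M a := LinearMap.congr_fun (TensorProduct.ext'
    (g := (e T).toLinearMap ∘ₗ TensorProduct.map (F.map M) (G.map M))
    (h := K.map M ∘ₗ (e S).toLinearMap) fun a b => h₁ M a b) a
  app_unit := by
    change e _ (TensorProduct.congr F.unit G.unit ((TensorProduct.lid k k).symm 1)) = _
    simpa using h₂
  app_tensor {S T} a b := LinearMap.congr_fun (TensorProduct.ext_fourfold'
    (φ := (e _).toLinearMap ∘ₗ ((F.mul G).tensor S T).toLinearMap)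
    (ψ := (K.tensor S T).toLinearMap ∘ₗ
      TensorProduct.map (e S).toLinearMap (e T).toLinearMap) fun a b a' b' => h₃ a b a' b') (a ⊗ₜ b)

/-- The product of TQFTs respects isomorphisms. -/
def TQFT.Iso.mul {F F' G G' : TQFT k d} (e : F.Iso F') (e' : G.Iso G') :
    (F.mul G).Iso (F'.mul G') :=
  .ofMul (fun S => TensorProduct.congr (e.app S) (e'.app S))
    (fun M a b => by
      change e.app _ (F.map M a) ⊗ₜ e'.app _ (G.map M b) =
        F'.map M (e.app _ a) ⊗ₜ G'.map M (e'.app _ b)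
      rw [e.naturality, e'.naturality])
    (by
      change e.app _ (F.unit 1) ⊗ₜ e'.app _ (G.unit 1) = F'.unit 1 ⊗ₜ G'.unit 1
      rw [e.app_unit, e'.app_unit])
    (fun a b a' b' => by
      change e.app _ (F.tensor _ _ (a ⊗ₜ a')) ⊗ₜ e'.app _ (G.tensor _ _ (b ⊗ₜ b')) =
        F'.tensor _ _ (e.app _ a ⊗ₜ e.app _ a') ⊗ₜ G'.tensor _ _ (e'.app _ b ⊗ₜ e'.app _ b')
      rw [e.app_tensor, e'.app_tensor])

/-- Commutativity of the product of TQFTs. -/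
def TQFT.Iso.comm (F G : TQFT k d) : (F.mul G).Iso (G.mul F) :=
  .ofMul (fun S => TensorProduct.comm k (F.obj S) (G.obj S)) (fun _ _ _ => rfl)
    rfl (fun _ _ _ _ => rfl)

/-- The trivial TQFT is an identity element. -/
def TQFT.Iso.one (F : TQFT k d) : ((TQFT.trivial k d).mul F).Iso F :=
  .ofMul (fun S => TensorProduct.lid k (F.obj S)) (fun M (a : k) b => by
      change a • F.map M b = F.map M (a • b)
      rw [map_smul])
    (by
      change (1 : k) • F.unit 1 = F.unit 1
      rw [one_smul])
    (fun {S T} (a : k) b (a' : k) b' => by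
      change (a • a') • F.tensor S T (b ⊗ₜ b') = F.tensor S T ((a • b) ⊗ₜ (a' • b'))
      rw [TensorProduct.smul_tmul_smul, map_smul, smul_eq_mul])

/-- Associativity of the product of TQFTs. -/
def TQFT.Iso.assoc (F G K : TQFT k d) : ((F.mul G).mul K).Iso (F.mul (G.mul K)) :=
  .ofMul (fun S => TensorProduct.assoc k (F.obj S) (G.obj S) (K.obj S))
    (fun {S T} M a b => LinearMap.congr_fun (TensorProduct.ext_threefold
      (g := (TensorProduct.assoc k (F.obj T) (G.obj T) (K.obj T)).toLinearMap ∘ₗ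
        TensorProduct.map (TensorProduct.map (F.map M) (G.map M)) (K.map M))
      (h := TensorProduct.map (F.map M) (TensorProduct.map (G.map M) (K.map M)) ∘ₗ
        (TensorProduct.assoc k (F.obj S) (G.obj S) (K.obj S)).toLinearMap)
      fun _ _ _ => rfl) (a ⊗ₜ b))
    rfl
    (fun {S T} a b a' b' => LinearMap.congr_fun (TensorProduct.ext_fourfold'
      (φ := (TensorProduct.assoc k _ _ _).toLinearMap ∘ₗ
        (TensorProduct.mk k _ _).flip (K.tensor S T (b ⊗ₜ b')) ∘ₗ
          ((F.mul G).tensor S T).toLinearMap)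
      (ψ := ((F.mul (G.mul K)).tensor S T).toLinearMap ∘ₗ TensorProduct.map
        ((TensorProduct.assoc k _ _ _).toLinearMap ∘ₗ (TensorProduct.mk k _ _).flip b)
        ((TensorProduct.assoc k _ _ _).toLinearMap ∘ₗ (TensorProduct.mk k _ _).flip b'))
      fun _ _ _ _ => rfl) (a ⊗ₜ a'))

/-- The isomorphism classes of TQFTs form a commutative monoid under the product of TQFTs, with
the class of the trivial TQFT as the identity element. -/
instance : CommMonoid (TQFTClass k d) where
  mul := Quotient.map₂ TQFT.mul fun _ _ ⟨e⟩ _ _ ⟨e'⟩ => ⟨e.mul e'⟩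
  one := (TQFT.trivial k d).toClass
  mul_assoc := by
    rintro ⟨F⟩ ⟨G⟩ ⟨K⟩
    exact Quotient.sound ⟨.assoc F G K⟩
  mul_comm := by
    rintro ⟨F⟩ ⟨G⟩
    exact Quotient.sound ⟨.comm F G⟩
  one_mul := by
    rintro ⟨F⟩
    exact Quotient.sound ⟨.one F⟩
  mul_one := by
    rintro ⟨F⟩
    exact Quotient.sound ⟨(TQFT.Iso.comm F (.trivial k d)).trans (.one F)⟩

variable (k d) in
/-- The group `nTQFT_k^×`, `n = d + 1`, of (isomorphism classes of) invertible TQFTs, that is, of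
TQFTs `F` for which there is a TQFT `G` such that the product of `F` and `G` is isomorphic to the
trivial TQFT. -/
abbrev InvertibleTQFTGroup := (TQFTClass k d)ˣ

/-- The scalar `δ (F X)` by which `F` acts on the value of the empty manifold, for a closed
`n`-manifold `X` regarded as a cobordism from the empty manifold to itself; the value of the empty
manifold is identified with `k`, and `Hom_k (k, k)` with `k` through `δ φ = φ 1`. -/
def TQFT.closedValue (F : TQFT k d) (X : ClosedBulk d) : k :=
  F.unit.symm (F.map X.toCobordism (F.unit 1))

/-- `F M = id` for each cobordism `M` with empty boundary. -/
def TQFT.IsTrivialOnClosed (F : TQFT k d) : Prop :=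
  ∀ M : Cobordism (CompactOriented.empty (𝓡 d)) (CompactOriented.empty (𝓡 d)),
    F.map M = LinearMap.id

lemma TQFT.IsTrivialOnClosed.of_iso {F G : TQFT k d} (e : F.Iso G) (h : F.IsTrivialOnClosed) :
    G.IsTrivialOnClosed := fun M => by
  ext a
  obtain ⟨b, rfl⟩ := (e.app _).surjective a
  rw [← e.naturality, h M]
  rfl

lemma TQFT.IsTrivialOnClosed.mul {F G : TQFT k d} (hF : F.IsTrivialOnClosed)
    (hG : G.IsTrivialOnClosed) : (F.mul G).IsTrivialOnClosed := fun M => by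
  change TensorProduct.map (F.map M) (G.map M) = LinearMap.id
  rw [hF M, hG M, TensorProduct.map_id]

lemma TQFT.IsTrivialOnClosed.of_mul {F G : TQFT k d} (hF : F.IsTrivialOnClosed)
    (h : (F.mul G).IsTrivialOnClosed) : G.IsTrivialOnClosed := fun M => by
  have e : TensorProduct.map (F.map M) (G.map M) = LinearMap.id := h M
  rw [hF M] at e
  ext b
  have e' := LinearMap.congr_fun e (F.unit 1 ⊗ₜ b)
  have e'' := congrArg (fun z => TensorProduct.lid k _
    (TensorProduct.map F.unit.symm.toLinearMap LinearMap.id z)) e'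
  simpa using e''

variable (k d) in
/-- The subgroup of the invertible TQFTs `F` with `F M = id` for each cobordism `M` with empty
boundary. -/
def trivialOnClosed : Subgroup (InvertibleTQFTGroup k d) where
  carrier := {u | ∀ F : TQFT k d, F.toClass = u → F.IsTrivialOnClosed}
  one_mem' F h := by
    obtain ⟨e⟩ := Quotient.exact h
    exact .of_iso e.symm fun _ => rfl
  mul_mem' {u v} hu hv F h := by
    obtain ⟨F₁, h₁⟩ := Quotient.exists_rep (u : TQFTClass k d)
    obtain ⟨F₂, h₂⟩ := Quotient.exists_rep (v : TQFTClass k d)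
    have h' : F.toClass = (F₁.mul F₂).toClass := by
      rw [h, Units.val_mul, ← h₁, ← h₂]; rfl
    obtain ⟨e⟩ := Quotient.exact h'
    exact .of_iso e.symm ((hu F₁ h₁).mul (hv F₂ h₂))
  inv_mem' {u} hu F h := by
    obtain ⟨F₁, h₁⟩ := Quotient.exists_rep (u : TQFTClass k d)
    have h' : (TQFT.trivial k d).toClass = (F₁.mul F).toClass := by
      change 1 = F₁.toClass * F.toClass
      rw [h, show F₁.toClass = (u : TQFTClass k d) from h₁, Units.mul_inv]
    obtain ⟨e⟩ := Quotient.exact h'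
    exact .of_mul (hu F₁ h₁) (.of_iso e fun _ => rfl)

/-- The defining property of the homomorphism `Ψ_n : nTQFT_k^× → Hom (SKK_n, k^×)`, `n = d + 1`:
`Ψ_n (F) ([X]) = δ (F X)` for all invertible TQFTs `F` and closed `n`-manifolds `X`. -/
def IsPsi (Ψ : InvertibleTQFTGroup k d →* (Multiplicative (SKK d) →* kˣ)) : Prop :=
  ∀ (u : InvertibleTQFTGroup k d) (F : TQFT k d), F.toClass = u → ∀ X : ClosedBulk d,
    (Ψ u (Multiplicative.ofAdd X.toSKK) : k) = F.closedValue X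

end TQFT

end
end InvertibleTQFT

namespace InvertibleTQFT

noncomputable section

/-!
Writing `X₁ ∪_f X₂` as the composite of `X₁` and `X₂.precomp f`, the whole theorem rests on one
gluing: the cylinder over `S`, attached along its out-boundary to the in-boundary of a cobordism
`N`, gives `N` again. A collar `c : S × [0,∞) → N` of the in-boundary provides it: the cylinder is
embedded by the restriction of `c` to `S × [0,1]`, and `N` is pushed off its boundary by
`c (x, t) ↦ c (x, s t)`, where `s` embeds `[0,∞)` onto `[1,∞)` and is the identity far away. Both
maps preserve orientation because the points where they do form a clopen set, and along each collar
line there is a point where this is clear.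

Reparametrizing the in-boundary of the cylinder by `f` yields a cobordism `C_f` with
`F (X₁ ∪_f X₂) = F X₂ ∘ F C_f ∘ F X₁` for every TQFT `F`. If `F` is invertible, then `F S` is a
line, so `F C_f` is a scalar that depends on `f` only, and `F` satisfies the relations of `SKK_n`.
-/

/-! ### Signs of frames -/

section OrientSign

variable {V : Type*} [AddCommGroup V] [Module ℝ V] {n : ℕ}

lemma orientSign_rayOfNeZero {α : V [⋀^Fin n]→ₗ[ℝ] ℝ} (h : α ≠ 0) (v : Fin n → V) :
    orientSign (rayOfNeZero ℝ α h) v = SignType.sign (α v) := by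
  have hne := Module.Ray.someVector_ne_zero (rayOfNeZero ℝ α h)
  have hray : SameRay ℝ (Module.Ray.someVector (rayOfNeZero ℝ α h)) α := by
    rw [← ray_eq_iff hne h, Module.Ray.someVector_ray]
  obtain ⟨r, hr, hrα⟩ := hray.exists_pos_right hne h
  rw [orientSign, hrα, AlternatingMap.smul_apply, smul_eq_mul, sign_mul, sign_pos hr, one_mul]

variable (b : Module.Basis (Fin n) ℝ V)

include b in
lemma alternatingMap_apply_eq_mul_det (α : V [⋀^Fin n]→ₗ[ℝ] ℝ) (v : Fin n → V) :
    α v = α b * b.det v := by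
  conv_lhs => rw [α.eq_smul_basis_det b]
  rfl

include b in
lemma sign_alternatingMap_eq_of_eq {α β : V [⋀^Fin n]→ₗ[ℝ] ℝ} {v₀ : Fin n → V}
    (h₀ : SignType.sign (β v₀) ≠ 0) (h : SignType.sign (α v₀) = SignType.sign (β v₀))
    (v : Fin n → V) : SignType.sign (α v) = SignType.sign (β v) := by
  rw [alternatingMap_apply_eq_mul_det b α, alternatingMap_apply_eq_mul_det b β, sign_mul,
    sign_mul] at *
  rw [mul_right_cancel₀ (right_ne_zero_of_mul h₀) h]

lemma orientSign_eq_mul_sign_det (o : Orientation ℝ V (Fin n)) (v : Fin n → V) :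
    orientSign o v = orientSign o b * SignType.sign (b.det v) := by
  rw [orientSign, alternatingMap_apply_eq_mul_det b, sign_mul, orientSign]

lemma orientSign_basis_ne_zero (o : Orientation ℝ V (Fin n)) : orientSign o b ≠ 0 := fun h => by
  rw [orientSign, sign_eq_zero_iff] at h
  refine o.someVector_ne_zero (AlternatingMap.ext fun v => ?_)
  rw [alternatingMap_apply_eq_mul_det b, h, zero_mul, AlternatingMap.zero_apply]

include b in
lemma orientSign_map (o : Orientation ℝ V (Fin n)) (A : V →ₗ[ℝ] V) (v : Fin n → V) :
    orientSign o (fun i => A (v i)) = SignType.sign (LinearMap.det A) * orientSign o v := by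
  have hdet : b.det (fun i => A (v i)) = LinearMap.det A * b.det v := b.det_comp A v
  rw [orientSign_eq_mul_sign_det b o, hdet, orientSign_eq_mul_sign_det b o v, sign_mul,
    mul_left_comm]

lemma exists_orientSign_eq_mul_sign_det {s : SignType} (hs : s ≠ 0) :
    ∃ o : Orientation ℝ V (Fin n), ∀ v, orientSign o v = s * SignType.sign (b.det v) := by
  have hα : (s : ℝ) • b.det ≠ 0 :=
    smul_ne_zero (by revert hs; cases s <;> simp) b.det_ne_zero
  refine ⟨rayOfNeZero ℝ _ hα, fun v => ?_⟩
  rw [orientSign_rayOfNeZero, AlternatingMap.smul_apply, smul_eq_mul, sign_mul]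
  cases s <;> simp

end OrientSign

/-- The standard basis of `ℝⁿ`. -/
abbrev stdBasis (n : ℕ) : Module.Basis (Fin n) ℝ (EuclideanSpace ℝ (Fin n)) :=
  (EuclideanSpace.basisFun (Fin n) ℝ).toBasis

section FrameSign

variable {n : ℕ} {H : Type} [TopologicalSpace H]
  {I : ModelWithCorners ℝ (EuclideanSpace ℝ (Fin n)) H} {M P Q : CompactOriented I}

/-- The sign of a frame of `ℝⁿ`, regarded as a frame of the tangent space at `x` through the
preferred chart. Unlike `orientSign (M.orient x)` it does not mention the tangent space, so that
signs at different points can be compared. -/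
def frameSign (M : CompactOriented I) (x : M) (v : Fin n → EuclideanSpace ℝ (Fin n)) : SignType :=
  orientSign (M.orient x) v

lemma frameSign_eq_mul_sign_det (x : M) (v : Fin n → EuclideanSpace ℝ (Fin n)) :
    frameSign M x v = frameSign M x (stdBasis n) * SignType.sign ((stdBasis n).det v) :=
  orientSign_eq_mul_sign_det (V := EuclideanSpace ℝ (Fin n)) (stdBasis n) (M.orient x) v

lemma frameSign_stdBasis_ne_zero (x : M) : frameSign M x (stdBasis n) ≠ 0 :=
  orientSign_basis_ne_zero (V := EuclideanSpace ℝ (Fin n)) (stdBasis n) (M.orient x)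

lemma frameSign_map (x : M) (A : EuclideanSpace ℝ (Fin n) →L[ℝ] EuclideanSpace ℝ (Fin n))
    (v : Fin n → EuclideanSpace ℝ (Fin n)) :
    frameSign M x (fun i => A (v i)) = SignType.sign A.det * frameSign M x v :=
  orientSign_map (V := EuclideanSpace ℝ (Fin n)) (stdBasis n) (M.orient x) A v

lemma eventually_frameSign_tangentCoordChange (M : CompactOriented I) (x : M) :
    ∀ᶠ y in 𝓝 x, ∀ v : Fin n → EuclideanSpace ℝ (Fin n),
      frameSign M x (fun i => tangentCoordChange I y x y (v i)) = frameSign M y v :=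
  M.orient_locally_constant x

/-- The differential of `g` at `x` preserves the orientation. -/
def PreservesOrientationAt (P Q : CompactOriented I) (g : P → Q) (x : P) : Prop :=
  ∀ v : Fin n → EuclideanSpace ℝ (Fin n),
    frameSign Q (g x) (fun i => mfderiv I I g x (v i)) = frameSign P x v

lemma PreservesOrientationAt.of_frameSign_eq {g : P → Q} {x : P}
    {v₀ : Fin n → EuclideanSpace ℝ (Fin n)} (h₀ : frameSign P x v₀ ≠ 0)
    (h : frameSign Q (g x) (fun i => mfderiv I I g x (v₀ i)) = frameSign P x v₀) :
    PreservesOrientationAt P Q g x :=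
  sign_alternatingMap_eq_of_eq (V := EuclideanSpace ℝ (Fin n)) (stdBasis n)
    (α := (Q.orient (g x)).someVector.compLinearMap (mfderiv I I g x).toLinearMap) h₀ h

lemma eventually_preservesOrientationAt_iff_sign_det {g : P → Q} (hg : Continuous g) (x : P) :
    ∀ᶠ y in 𝓝 x, PreservesOrientationAt P Q g y ↔ ∀ w : Fin n → EuclideanSpace ℝ (Fin n),
      SignType.sign (inTangentCoordinates I I id g (mfderiv I I g) x y).det *
        frameSign Q (g x) w = frameSign P x w := by
  have hgx := hg.tendsto x
  filter_upwards [eventually_frameSign_tangentCoordChange P x,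
    hgx.eventually (eventually_frameSign_tangentCoordChange Q (g x)),
    chart_source_mem_nhds H x, hgx.eventually (chart_source_mem_nhds H (g x))] with y hP hQ hy hgy
  let T := tangentCoordChange I y x y
  let T' := tangentCoordChange I x y y
  let A : EuclideanSpace ℝ (Fin n) →L[ℝ] EuclideanSpace ℝ (Fin n) :=
    inTangentCoordinates I I id g (mfderiv I I g) x y
  have hT'T (v) : T' (T v) = v := by
    rw [tangentCoordChange_comp (by simp [hy]), tangentCoordChange_self (by simp)]
  have hTT' (v) : T (T' v) = v := by
    rw [tangentCoordChange_comp (by simp [hy]), tangentCoordChange_self (by simpa using hy)]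
  have hA (v) : A v = tangentCoordChange I (g y) (g x) (g y) (mfderiv I I g y (T' v)) :=
    congrArg (fun L : EuclideanSpace ℝ (Fin n) →L[ℝ] EuclideanSpace ℝ (Fin n) => L v)
      (inTangentCoordinates_eq (I := I) (I' := I) (f := id) (g := g)
        (ϕ := mfderiv I I g) (x₀ := x) (x := y) hy hgy)
  calc PreservesOrientationAt P Q g y
      ↔ ∀ v : Fin n → EuclideanSpace ℝ (Fin n),
          frameSign Q (g x) (fun i => A (T (v i))) = frameSign P x (fun i => T (v i)) := by
        refine forall_congr' fun v => ?_
        simp only [hA, hT'T]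
        exact iff_of_eq (congrArg₂ (· = ·) (hQ _).symm (hP v).symm)
    _ ↔ ∀ w : Fin n → EuclideanSpace ℝ (Fin n),
          frameSign Q (g x) (fun i => A (w i)) = frameSign P x w :=
        ⟨fun h w => by simpa only [hTT'] using h fun i => T' (w i), fun h v => h _⟩
    _ ↔ _ := forall_congr' fun w => by rw [frameSign_map]

lemma eventually_preservesOrientationAt_iff {g : P → Q} (hg : ContMDiff I I ∞ g) {x : P}
    (hx : Function.Injective (mfderiv I I g x)) :
    ∀ᶠ y in 𝓝 x, (PreservesOrientationAt P Q g y ↔ PreservesOrientationAt P Q g x) := by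
  let A : P → EuclideanSpace ℝ (Fin n) →L[ℝ] EuclideanSpace ℝ (Fin n) :=
    inTangentCoordinates I I id g (mfderiv I I g) x
  have hA : ContinuousAt (fun y => (A y).det) x :=
    ContinuousLinearMap.continuous_det.continuousAt.comp
      ((hg x).mfderiv_const (m := 0) (by simp)).continuousAt
  have hAx (v : EuclideanSpace ℝ (Fin n)) : A x v = mfderiv I I g x v := by
    refine (congrArg (fun L : EuclideanSpace ℝ (Fin n) →L[ℝ] EuclideanSpace ℝ (Fin n) => L v)
      (inTangentCoordinates_eq (I := I) (I' := I) (f := id) (g := g) (ϕ := mfderiv I I g)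
        (x₀ := x) (x := x) (mem_chart_source H x) (mem_chart_source H (g x)))).trans ?_
    exact (tangentCoordChange_self (by simp)).trans (congrArg (mfderiv I I g x)
      (tangentCoordChange_self (by simp) : tangentCoordChange I x x x v = v))
  have hdet : (A x).det ≠ 0 := by
    have hinj : Function.Injective (A x) := fun v w h =>
      @hx v w ((hAx v).symm.trans (h.trans (hAx w)))
    exact (LinearEquiv.ofInjectiveEndo (A x).toLinearMap hinj).isUnit_det'.ne_zero
  have hsign : ∀ᶠ y in 𝓝 x, SignType.sign (A y).det = SignType.sign (A x).det :=
    (ContinuousAt.comp (g := SignType.sign) (f := fun y => (A y).det)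
      (continuousAt_sign_of_ne_zero hdet) hA).eventually_mem
        ((isOpen_discrete {SignType.sign (A x).det}).mem_nhds rfl)
  have hiff := eventually_preservesOrientationAt_iff_sign_det hg.continuous x
  filter_upwards [hiff, hsign] with y hy hsign_y
  rw [hy, hiff.self_of_nhds]
  exact forall_congr' fun w => by rw [← hsign_y]

lemma isClopen_preservesOrientationAt {g : P → Q} (hg : ContMDiff I I ∞ g)
    (hinj : ∀ x, Function.Injective (mfderiv I I g x)) :
    IsClopen {x | PreservesOrientationAt P Q g x} := by
  refine ⟨isOpen_compl_iff.1 (isOpen_iff_mem_nhds.2 fun x hx => ?_),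
    isOpen_iff_mem_nhds.2 fun x hx => ?_⟩ <;>
  filter_upwards [eventually_preservesOrientationAt_iff hg (hinj x)] with y hy
  exacts [mt hy.1 hx, hy.2 hx]

end FrameSign

/-! ### Change of the model space -/

section ModelTransfer

variable {E E' H H' M : Type} [NormedAddCommGroup E] [NormedSpace ℝ E] [NormedAddCommGroup E']
  [NormedSpace ℝ E'] [TopologicalSpace H] [TopologicalSpace H'] [TopologicalSpace M]
  {I : ModelWithCorners ℝ E H} {I' : ModelWithCorners ℝ E' H'} {h : H ≃ₜ H'} {L : E ≃L[ℝ] E'}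

/-- The charted space structure over `H'` obtained by composing the charts of `M` with a
homeomorphism `h : H ≃ₜ H'` of model spaces. In the lemmas below `h` is the restriction of a linear
isomorphism `L`, so that the smooth structure does not change. -/
@[reducible]
def transferChartedSpace (h : H ≃ₜ H') (M : Type) [TopologicalSpace M] [ChartedSpace H M] :
    ChartedSpace H' M where
  atlas := (fun e => e.transHomeomorph h) '' atlas H M
  chartAt x := (chartAt H x).transHomeomorph h
  mem_chart_source x := mem_chart_source H x
  chart_mem_atlas x := ⟨_, chart_mem_atlas H x, rfl⟩

variable (hL : ∀ z, I' (h z) = L (I z))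

include hL

lemma mem_range_transfer {z : E'} : z ∈ Set.range I' ↔ L.symm z ∈ Set.range I := by
  rw [← h.surjective.range_comp, show I' ∘ h = L ∘ I from funext hL, Set.range_comp,
    L.image_eq_preimage_symm, Set.mem_preimage]

lemma transfer_symm_apply {z : E'} (hz : z ∈ Set.range I') :
    h.symm (I'.symm z) = I.symm (L.symm z) := by
  obtain ⟨w, rfl⟩ := hz
  obtain ⟨w, rfl⟩ := h.surjective w
  rw [I'.left_inv, hL, L.symm_apply_apply, I.left_inv, h.symm_apply_apply]

variable [ChartedSpace H M]

lemma isManifold_transfer [IsManifold I ∞ M] :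
    letI := transferChartedSpace h M
    IsManifold I' ∞ M := by
  let := transferChartedSpace h M
  refine isManifold_of_contDiffOn I' ∞ M ?_
  rintro _ _ ⟨e, he, rfl⟩ ⟨e', he', rfl⟩
  have hchange : ContDiffOn ℝ ∞ (I ∘ e.symm.trans e' ∘ I.symm)
      (I.symm ⁻¹' (e.symm.trans e').source ∩ Set.range I) :=
    ((contDiffGroupoid ∞ I).compatible he he').1
  have hconj := (L.contDiff.comp_contDiffOn hchange).comp
    (s := I'.symm ⁻¹' ((e.transHomeomorph h).symm.trans (e'.transHomeomorph h)).source ∩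
      Set.range I') L.symm.contDiff.contDiffOn fun z hz =>
        ⟨by simpa [transfer_symm_apply hL hz.2] using hz.1, (mem_range_transfer hL).1 hz.2⟩
  exact hconj.congr fun z hz => by simp [transfer_symm_apply hL hz.2, hL]

lemma extChartAt_transfer (x y : M) :
    letI := transferChartedSpace h M
    extChartAt I' x y = L (extChartAt I x y) :=
  hL _

lemma extChartAt_transfer_symm (x : M) {z : E'} (hz : z ∈ Set.range I') :
    letI := transferChartedSpace h M
    (extChartAt I' x).symm z = (extChartAt I x).symm (L.symm z) :=
  congrArg (chartAt H x).symm (transfer_symm_apply hL hz)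

lemma contMDiff_transfer [IsManifold I ∞ M] :
    letI := transferChartedSpace h M
    ContMDiff I I' ∞ (fun x : M => x) := by
  let := transferChartedSpace h M
  refine fun x => contMDiffAt_iff.2 ⟨continuousAt_id,
    L.contDiff.contDiffWithinAt.congr_of_eventuallyEq_of_mem ?_ (by simp)⟩
  filter_upwards [extChartAt_target_mem_nhdsWithin (I := I) x] with z hz
  exact (extChartAt_transfer hL x _).trans (congrArg L ((extChartAt I x).right_inv hz))

lemma contMDiff_transfer_symm [IsManifold I ∞ M] :
    letI := transferChartedSpace h M
    ContMDiff I' I ∞ (fun x : M => x) := by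
  let := transferChartedSpace h M
  refine fun x => contMDiffAt_iff.2 ⟨continuousAt_id,
    L.symm.contDiff.contDiffWithinAt.congr_of_eventuallyEq_of_mem ?_ (by simp)⟩
  filter_upwards [extChartAt_target_mem_nhdsWithin (I := I') x] with z hz
  refine (L.symm_apply_eq.2 ?_).symm
  exact ((extChartAt I' x).right_inv hz).symm.trans (extChartAt_transfer hL x _)

lemma tangentCoordChange_transfer [IsManifold I ∞ M] {x y z : M}
    (hz : z ∈ (extChartAt I x).source ∩ (extChartAt I y).source) :
    letI := transferChartedSpace h M
    haveI : IsManifold I' ∞ M := isManifold_transfer hL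
    tangentCoordChange I' x y z =
      (L : E →L[ℝ] E').comp ((tangentCoordChange I x y z).comp (L.symm : E' →L[ℝ] E)) := by
  let := transferChartedSpace h M
  have : IsManifold I' ∞ M := isManifold_transfer hL
  have hx : L.symm (extChartAt I' x z) = extChartAt I x z :=
    L.symm_apply_eq.2 (extChartAt_transfer hL x z)
  have hchange : HasFDerivWithinAt ((extChartAt I y ∘ (extChartAt I x).symm) ∘ L.symm)
      ((tangentCoordChange I x y z).comp (L.symm : E' →L[ℝ] E)) (Set.range I')
      (extChartAt I' x z) :=
    HasFDerivWithinAt.comp (g := extChartAt I y ∘ (extChartAt I x).symm) (t := Set.range I) _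
      (hx ▸ hasFDerivWithinAt_tangentCoordChange hz) L.symm.hasFDerivWithinAt
      fun w hw => (mem_range_transfer hL).1 hw
  have heq (w) (hw : w ∈ Set.range I') : (extChartAt I' y ∘ (extChartAt I' x).symm) w =
      (L ∘ (extChartAt I y ∘ (extChartAt I x).symm) ∘ L.symm) w :=
    (extChartAt_transfer hL y _).trans
      (congrArg (fun p => L (extChartAt I y p)) (extChartAt_transfer_symm hL x hw))
  rw [tangentCoordChange_def]
  exact ((L.hasFDerivAt.comp_hasFDerivWithinAt _ hchange).congr heq (heq _ ⟨_, rfl⟩)).fderivWithin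
    (I'.uniqueDiffOn _ ⟨_, rfl⟩)

lemma mfderiv_transfer [IsManifold I ∞ M] (x : M) :
    letI := transferChartedSpace h M
    mfderiv I I' (fun x : M => x) x = (L : E →L[ℝ] E') := by
  let := transferChartedSpace h M
  have heq (z) (hz : z ∈ (extChartAt I x).target) :
      writtenInExtChartAt I I' x (fun x : M => x) z = L z :=
    (extChartAt_transfer hL x _).trans (congrArg L ((extChartAt I x).right_inv hz))
  have hderiv : HasFDerivWithinAt (writtenInExtChartAt I I' x fun x : M => x) (L : E →L[ℝ] E')
      (Set.range I) (extChartAt I x x) := by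
    refine L.hasFDerivWithinAt.congr_of_eventuallyEq ?_ (heq _ (mem_extChartAt_target x))
    filter_upwards [extChartAt_target_mem_nhdsWithin (I := I) x] with z hz using heq z hz
  exact HasMFDerivAt.mfderiv ⟨continuousAt_id, hderiv⟩

end ModelTransfer

lemma tangentCoordChange_prod {E E' H H' M N : Type} [NormedAddCommGroup E] [NormedSpace ℝ E]
    [NormedAddCommGroup E'] [NormedSpace ℝ E'] [TopologicalSpace H] [TopologicalSpace H']
    [TopologicalSpace M] [TopologicalSpace N] {I : ModelWithCorners ℝ E H}
    {J : ModelWithCorners ℝ E' H'} [ChartedSpace H M] [ChartedSpace H' N] [IsManifold I ∞ M]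
    [IsManifold J ∞ N] {p q r : M × N}
    (h : r ∈ (extChartAt (I.prod J) p).source ∩ (extChartAt (I.prod J) q).source) :
    tangentCoordChange (I.prod J) p q r =
      (tangentCoordChange I p.1 q.1 r.1).prodMap (tangentCoordChange J p.2 q.2 r.2) := by
  rw [extChartAt_prod, extChartAt_prod] at h
  have hfst := hasFDerivWithinAt_tangentCoordChange (I := I) (x := p.1) (y := q.1) (z := r.1)
    ⟨h.1.1, h.2.1⟩
  have hsnd := hasFDerivWithinAt_tangentCoordChange (I := J) (x := p.2) (y := q.2) (z := r.2)
    ⟨h.1.2, h.2.2⟩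
  have hrange : Set.range (I.prod J) = Set.range I ×ˢ Set.range J := by
    rw [modelWithCorners_prod_coe, Set.range_prodMap]
  have hprod : HasFDerivWithinAt (Prod.map (extChartAt I q.1 ∘ (extChartAt I p.1).symm)
      (extChartAt J q.2 ∘ (extChartAt J p.2).symm)) _ (Set.range I ×ˢ Set.range J)
      (extChartAt I p.1 r.1, extChartAt J p.2 r.2) :=
    (hfst.mono (Set.fst_image_prod_subset _ _)).prodMap _
      (hsnd.mono (Set.snd_image_prod_subset _ _))
  rw [tangentCoordChange_def, hrange, extChartAt_prod, extChartAt_prod]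
  exact hprod.fderivWithin
    ((I.uniqueDiffOn _ (Set.mem_range_self _)).prod (J.uniqueDiffOn _ (Set.mem_range_self _)))

/-! ### The cylinder -/

section Interval

/-- The sign of the preferred chart of `[0,1]` at `t` with respect to the standard orientation of
the interval: Mathlib's preferred chart is `IccRightChart`, which reverses the orientation, exactly
at `t = 1`. -/
def iccSign (t : Set.Icc (0 : ℝ) 1) : SignType := if t.val < 1 then 1 else -1

lemma iccSign_ne_zero (t : Set.Icc (0 : ℝ) 1) : iccSign t ≠ 0 := by
  unfold iccSign
  split_ifs <;> decide

lemma tangentCoordChange_Icc_of_iff {s t : Set.Icc (0 : ℝ) 1} (h : s.val < 1 ↔ t.val < 1) :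
    tangentCoordChange (𝓡∂ 1) s t s = ContinuousLinearMap.id ℝ (EuclideanSpace ℝ (Fin 1)) := by
  have hchart : extChartAt (𝓡∂ 1) t = extChartAt (𝓡∂ 1) s := by
    simp only [extChartAt, Icc_chartedSpaceChartAt, h]
  rw [tangentCoordChange_def, hchart, ← tangentCoordChange_def]
  ext v : 1
  exact tangentCoordChange_self (mem_extChartAt_source s)

lemma extChartAt_Icc_left_right {s t : Set.Icc (0 : ℝ) 1} (hs : s.val < 1) (ht : ¬ t.val < 1)
    {z : EuclideanSpace ℝ (Fin 1)} (hz₀ : 0 ≤ z 0) (hz₁ : z 0 ≤ 1) :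
    extChartAt (𝓡∂ 1) t ((extChartAt (𝓡∂ 1) s).symm z) = WithLp.toLp 2 (fun _ => 1) - z := by
  have hz : ((𝓡∂ 1).symm z).val 0 = z 0 := by
    simp [modelWithCornersEuclideanHalfSpace_symm_apply, hz₀]
  have hchange : extChartAt (𝓡∂ 1) t ((extChartAt (𝓡∂ 1) s).symm z) =
      (IccRightChart 0 1 ((IccLeftChart 0 1).symm ((𝓡∂ 1).symm z))).val := by
    simp only [extChartAt, Icc_chartedSpaceChartAt_of_le_top hs,
      Icc_chartedSpaceChartAt_of_top_le (not_lt.1 ht)]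
    rfl
  rw [hchange, IccLeftChart_symm_apply_of_le (by simpa [hz] using hz₁), IccRightChart_apply]
  ext i
  rw [Subsingleton.elim i 0]
  simp [hz]

lemma tangentCoordChange_Icc_left_right {s t : Set.Icc (0 : ℝ) 1} (hs : s.val < 1)
    (ht : ¬ t.val < 1) :
    tangentCoordChange (𝓡∂ 1) s t s = -ContinuousLinearMap.id ℝ (EuclideanSpace ℝ (Fin 1)) := by
  have hs₀ : extChartAt (𝓡∂ 1) s s 0 = s.val := by
    simp only [extChartAt, Icc_chartedSpaceChartAt_of_le_top hs]
    exact sub_zero s.val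
  have hderiv : HasFDerivWithinAt (fun z : EuclideanSpace ℝ (Fin 1) =>
      (WithLp.toLp 2 (fun _ => 1) : EuclideanSpace ℝ (Fin 1)) - z)
      (-ContinuousLinearMap.id ℝ (EuclideanSpace ℝ (Fin 1))) (Set.range (𝓡∂ 1))
      (extChartAt (𝓡∂ 1) s s) := (hasFDerivWithinAt_id _ _).const_sub _
  rw [tangentCoordChange_def]
  refine (hderiv.congr_of_eventuallyEq ?_ ?_).fderivWithin
    ((𝓡∂ 1).uniqueDiffOn _ (Set.mem_range_self _))
  · have hcoord : ContinuousAt (fun z : EuclideanSpace ℝ (Fin 1) => z 0)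
        (extChartAt (𝓡∂ 1) s s) := by fun_prop
    filter_upwards [nhdsWithin_le_nhds (hcoord.eventually_lt_const (hs₀.trans_lt hs)),
      self_mem_nhdsWithin] with z hz₁ hz
    rw [range_modelWithCornersEuclideanHalfSpace] at hz
    exact extChartAt_Icc_left_right hs ht hz hz₁.le
  · exact extChartAt_Icc_left_right hs ht (hs₀ ▸ s.2.1) (hs₀ ▸ s.2.2)

lemma eventually_iccSign_eq (t : Set.Icc (0 : ℝ) 1) : ∀ᶠ s in 𝓝 t,
    iccSign t * SignType.sign (tangentCoordChange (𝓡∂ 1) s t s).det = iccSign s := by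
  have hdet : (-ContinuousLinearMap.id ℝ (EuclideanSpace ℝ (Fin 1))).det = -1 := by
    simpa [ContinuousLinearMap.det] using
      LinearMap.det_smul (-1 : ℝ) (LinearMap.id (R := ℝ) (M := EuclideanSpace ℝ (Fin 1)))
  have hlt : ∀ᶠ s in 𝓝 t, t.val < 1 → s.val < 1 := by
    by_cases ht : t.val < 1
    · filter_upwards [continuous_subtype_val.continuousAt.eventually_lt_const ht] with s hs _
      exact hs
    · exact .of_forall fun s h => absurd h ht
  filter_upwards [hlt] with s hst
  by_cases hs : s.val < 1 <;> by_cases ht : t.val < 1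
  · rw [tangentCoordChange_Icc_of_iff (by simp [hs, ht])]
    simp [iccSign, hs, ht, ContinuousLinearMap.det]
  · rw [tangentCoordChange_Icc_left_right hs ht, hdet]
    simp [iccSign, hs, ht]
  · exact absurd (hst ht) hs
  · rw [tangentCoordChange_Icc_of_iff (by simp [hs, ht])]
    simp [iccSign, hs, ht, ContinuousLinearMap.det]

end Interval

section HalfSpace

variable (d : ℕ)

/-- The isomorphism `ℝᵈ × ℝ ≃ ℝᵈ⁺¹` that makes the last factor the first coordinate, which is the
coordinate normal to the boundary of `EuclideanHalfSpace (d + 1)`. -/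
def consEquiv : (EuclideanSpace ℝ (Fin d) × EuclideanSpace ℝ (Fin 1)) ≃L[ℝ]
    EuclideanSpace ℝ (Fin (d + 1)) :=
  LinearEquiv.toContinuousLinearEquiv
    { toFun := fun p => WithLp.toLp 2 (Fin.cons (p.2 0) p.1)
      invFun := fun z => (WithLp.toLp 2 fun i => z i.succ, WithLp.toLp 2 fun _ => z 0)
      map_add' := fun p q => by
        ext i
        cases i using Fin.cases <;> simp
      map_smul' := fun c p => by
        ext i
        cases i using Fin.cases <;> simp
      left_inv := fun p => by
        ext i
        · simp
        · simp [Subsingleton.elim i 0]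
      right_inv := fun z => by
        ext i
        cases i using Fin.cases <;> simp }

/-- The restriction `ℝᵈ × [0,∞) ≃ {z ∈ ℝᵈ⁺¹ | 0 ≤ z 0}` of `consEquiv d`. -/
def halfSpaceHomeomorph :
    ModelProd (EuclideanSpace ℝ (Fin d)) (EuclideanHalfSpace 1) ≃ₜ EuclideanHalfSpace (d + 1) where
  toFun p := ⟨consEquiv d (p.1, p.2.val), p.2.2⟩
  invFun z := (((consEquiv d).symm z.val).1, ⟨((consEquiv d).symm z.val).2, z.2⟩)
  left_inv p := by
    have h := (consEquiv d).symm_apply_apply (p.1, p.2.val)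
    exact Prod.ext (congrArg Prod.fst h :) (Subtype.ext (congrArg Prod.snd h :))
  right_inv z := Subtype.ext ((consEquiv d).apply_symm_apply z.val)
  continuous_toFun := ((consEquiv d).continuous.comp
    (continuous_fst.prodMk (continuous_subtype_val.comp continuous_snd))).subtype_mk _
  continuous_invFun := by
    have h := (consEquiv d).symm.continuous.comp
      (continuous_subtype_val (p := fun z : EuclideanSpace ℝ (Fin (d + 1)) => 0 ≤ z 0))
    exact (continuous_fst.comp h).prodMk ((continuous_snd.comp h).subtype_mk _)

lemma halfSpaceHomeomorph_apply (p : ModelProd (EuclideanSpace ℝ (Fin d)) (EuclideanHalfSpace 1)) :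
    (𝓡∂ (d + 1)) (halfSpaceHomeomorph d p) = consEquiv d (((𝓡 d).prod (𝓡∂ 1)) p) := rfl

variable {d}

lemma det_vecCons_consEquiv (v : EuclideanSpace ℝ (Fin (d + 1)))
    (w : Fin d → EuclideanSpace ℝ (Fin d)) :
    (stdBasis (d + 1)).det (Matrix.vecCons v fun i => consEquiv d (w i, 0)) =
      v 0 * (stdBasis d).det w := by
  have hrow (i : Fin d) :
      (stdBasis (d + 1)).toMatrix (Matrix.vecCons v fun i => consEquiv d (w i, 0)) 0 i.succ = 0 :=
    rfl
  rw [Module.Basis.det_apply, Module.Basis.det_apply, Matrix.det_succ_row_zero, Fin.sum_univ_succ,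
    Finset.sum_eq_zero fun i _ => by rw [hrow, mul_zero, zero_mul], add_zero, Fin.val_zero,
    pow_zero, one_mul, Fin.succAbove_zero]
  rfl

end HalfSpace

section Cylinder

variable {d : ℕ} (S : ClosedManifold d)

/-- The sign of the standard basis, in the preferred chart, at a point of `S × [0,1]` with the
product orientation: "outward vector first" makes `S × {1}` carry the orientation of `S`, since
`consEquiv` puts the coordinate of the interval first. -/
def cylinderSign (p : S × Set.Icc (0 : ℝ) 1) : SignType :=
  iccSign p.2 * frameSign S p.1 (stdBasis d)

lemma cylinderSign_ne_zero (p : S × Set.Icc (0 : ℝ) 1) : cylinderSign S p ≠ 0 :=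
  mul_ne_zero (iccSign_ne_zero _) (frameSign_stdBasis_ne_zero _)

/-- The charts of the product `S × [0,1]`, with values in the half-space of dimension `d + 1`. -/
@[reducible]
def cylinderChartedSpace : ChartedSpace (EuclideanHalfSpace (d + 1)) (S × Set.Icc (0 : ℝ) 1) :=
  transferChartedSpace (halfSpaceHomeomorph d) _

lemma isManifold_cylinder :
    letI := cylinderChartedSpace S
    IsManifold (𝓡∂ (d + 1)) ∞ (S × Set.Icc (0 : ℝ) 1) :=
  isManifold_transfer (I := (𝓡 d).prod (𝓡∂ 1)) (halfSpaceHomeomorph_apply d)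

lemma det_tangentCoordChange_cylinder {p q : S × Set.Icc (0 : ℝ) 1}
    (h : q ∈ (extChartAt ((𝓡 d).prod (𝓡∂ 1)) p).source) :
    letI := cylinderChartedSpace S
    haveI := isManifold_cylinder S
    (tangentCoordChange (𝓡∂ (d + 1)) q p q).det =
      (tangentCoordChange (𝓡 d) q.1 p.1 q.1).det * (tangentCoordChange (𝓡∂ 1) q.2 p.2 q.2).det := by
  have hconj := tangentCoordChange_transfer (I := (𝓡 d).prod (𝓡∂ 1))
    (halfSpaceHomeomorph_apply d) ⟨mem_extChartAt_source q, h⟩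
  rw [tangentCoordChange_prod ⟨mem_extChartAt_source q, h⟩] at hconj
  exact (congrArg ContinuousLinearMap.det hconj).trans
    ((LinearMap.det_conj _ (consEquiv d).toLinearEquiv).trans (LinearMap.det_prodMap _ _))

lemma eventually_cylinderSign_eq (p : S × Set.Icc (0 : ℝ) 1) :
    letI := cylinderChartedSpace S
    haveI := isManifold_cylinder S
    ∀ᶠ q in 𝓝 p, SignType.sign (tangentCoordChange (𝓡∂ (d + 1)) q p q).det * cylinderSign S p =
      cylinderSign S q := by
  filter_upwards [extChartAt_source_mem_nhds (I := (𝓡 d).prod (𝓡∂ 1)) p,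
    (continuous_fst.tendsto p).eventually (eventually_frameSign_tangentCoordChange S p.1),
    (continuous_snd.tendsto p).eventually (eventually_iccSign_eq p.2)] with q hq hS hIcc
  rw [det_tangentCoordChange_cylinder S hq, cylinderSign, cylinderSign, ← hIcc,
    ← hS, frameSign_map, sign_mul]
  ac_rfl

/-- The cylinder `S × [0,1]`. -/
def cylinderManifold : ManifoldWithBoundary d :=
  letI := cylinderChartedSpace S
  haveI := isManifold_cylinder S
  have exists_orientation (p : S × Set.Icc (0 : ℝ) 1) :=
    exists_orientSign_eq_mul_sign_det (stdBasis (d + 1)) (cylinderSign_ne_zero S p)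
  { carrier := S × Set.Icc (0 : ℝ) 1
    orient := fun p => (exists_orientation p).choose
    orient_locally_constant := fun p => by
      filter_upwards [eventually_cylinderSign_eq S p] with q hq v
      refine (orientSign_map (stdBasis (d + 1)) (exists_orientation p).choose
        (tangentCoordChange (𝓡∂ (d + 1)) q p q).toLinearMap v).trans ?_
      refine (congrArg (_ * ·) ((exists_orientation p).choose_spec v)).trans ?_
      refine Eq.trans ?_ ((exists_orientation q).choose_spec v).symm
      rw [← hq]
      exact (mul_assoc _ _ _).symm }

lemma frameSign_cylinder (p : cylinderManifold S)
    (v : Fin (d + 1) → EuclideanSpace ℝ (Fin (d + 1))) :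
    frameSign (cylinderManifold S) p v =
      cylinderSign S p * SignType.sign ((stdBasis (d + 1)).det v) :=
  (exists_orientSign_eq_mul_sign_det (stdBasis (d + 1)) (cylinderSign_ne_zero S p)).choose_spec v

/-- The identity map from `S × [0,1]`, with the smooth structure of a product, to the cylinder. -/
def cylinderDiffeomorph : Diffeomorph ((𝓡 d).prod (𝓡∂ 1)) (𝓡∂ (d + 1))
    (S × Set.Icc (0 : ℝ) 1) (cylinderManifold S) ∞ where
  toFun p := p
  invFun p := p
  left_inv _ := rfl
  right_inv _ := rfl
  contMDiff_toFun := contMDiff_transfer (M := S × Set.Icc (0 : ℝ) 1) (I := (𝓡 d).prod (𝓡∂ 1))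
    (halfSpaceHomeomorph_apply d)
  contMDiff_invFun := contMDiff_transfer_symm (M := S × Set.Icc (0 : ℝ) 1)
    (I := (𝓡 d).prod (𝓡∂ 1)) (halfSpaceHomeomorph_apply d)

lemma boundary_cylinder : (𝓡∂ (d + 1)).boundary (cylinderManifold S) =
    Set.range (fun x : S => cylinderDiffeomorph S (x, 0)) ∪
      Set.range fun x : S => cylinderDiffeomorph S (x, 1) := by
  rw [← (cylinderDiffeomorph S).image_boundary (by simp), boundary_product]
  ext p
  constructor
  · rintro ⟨⟨x, t⟩, ⟨-, rfl | rfl⟩, rfl⟩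
    exacts [Or.inl ⟨x, rfl⟩, Or.inr ⟨x, rfl⟩]
  · rintro (⟨x, rfl⟩ | ⟨x, rfl⟩)
    exacts [⟨(x, 0), ⟨trivial, Or.inl rfl⟩, rfl⟩, ⟨(x, 1), ⟨trivial, Or.inr rfl⟩, rfl⟩]

lemma contMDiff_cylinder_slice (t : Set.Icc (0 : ℝ) 1) :
    ContMDiff (𝓡 d) (𝓡∂ (d + 1)) ∞ (fun x : S => cylinderDiffeomorph S (x, t)) :=
  (cylinderDiffeomorph S).contMDiff.comp (contMDiff_id.prodMk contMDiff_const)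

lemma mfderiv_cylinder_slice (t : Set.Icc (0 : ℝ) 1) (x : S) (w : EuclideanSpace ℝ (Fin d)) :
    mfderiv (𝓡 d) (𝓡∂ (d + 1)) (fun x : S => cylinderDiffeomorph S (x, t)) x w =
      consEquiv d (w, 0) := by
  have hcylinder := mfderiv_transfer (M := S × Set.Icc (0 : ℝ) 1) (I := (𝓡 d).prod (𝓡∂ 1))
    (halfSpaceHomeomorph_apply d) (x, t)
  have hcomp := mfderiv_comp_apply (I' := (𝓡 d).prod (𝓡∂ 1)) (f := fun x : S => (x, t)) x
    ((cylinderDiffeomorph S).mdifferentiable (by simp) (x, t))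
    (mdifferentiableAt_id.prodMk mdifferentiableAt_const) w
  refine hcomp.trans ?_
  rw [mfderiv_prod_left]
  exact congrArg (fun A : (EuclideanSpace ℝ (Fin d) × EuclideanSpace ℝ (Fin 1)) →L[ℝ]
    EuclideanSpace ℝ (Fin (d + 1)) => A (w, 0)) hcylinder

lemma frameSign_vecCons_cylinder (t : Set.Icc (0 : ℝ) 1) (x : S)
    (v : EuclideanSpace ℝ (Fin (d + 1))) (w : Fin d → EuclideanSpace ℝ (Fin d)) :
    frameSign (cylinderManifold S) (cylinderDiffeomorph S (x, t))
      (Matrix.vecCons v fun i => consEquiv d (w i, 0)) =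
      iccSign t * SignType.sign (v 0) * frameSign S x w := by
  rw [frameSign_cylinder, frameSign_eq_mul_sign_det x w, det_vecCons_consEquiv, sign_mul]
  exact mul_mul_mul_comm (G := SignType) _ _ _ _

lemma orientSign_cylinder_slice (t : Set.Icc (0 : ℝ) 1) (x : S)
    (v : TangentSpace (𝓡∂ (d + 1)) (cylinderDiffeomorph S (x, t)))
    (w : Fin d → TangentSpace (𝓡 d) x) :
    orientSign ((cylinderManifold S).orient (cylinderDiffeomorph S (x, t)))
      (Matrix.vecCons v (fun i =>
        mfderiv (𝓡 d) (𝓡∂ (d + 1)) (fun x : S => cylinderDiffeomorph S (x, t)) x (w i))) =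
      iccSign t * SignType.sign ((show EuclideanSpace ℝ (Fin (d + 1)) from v) 0) *
        orientSign (S.orient x) w := by
  have hslice : (fun i => mfderiv (𝓡 d) (𝓡∂ (d + 1)) (fun x : S => cylinderDiffeomorph S (x, t)) x
      (w i)) = fun i => consEquiv d (w i, 0) := funext fun i => mfderiv_cylinder_slice S t x (w i)
  rw [hslice]
  exact frameSign_vecCons_cylinder S t x v w

/-- The cylinder as a cobordism from `S` to `S`. -/
def cylinder : Cobordism S S where
  bulk := cylinderManifold S
  inMap x := cylinderDiffeomorph S (x, 0)
  outMap x := cylinderDiffeomorph S (x, 1)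
  contMDiff_inMap := contMDiff_cylinder_slice S 0
  contMDiff_outMap := contMDiff_cylinder_slice S 1
  injective_inMap _ _ h := congrArg Prod.fst ((cylinderDiffeomorph S).injective h)
  injective_outMap _ _ h := congrArg Prod.fst ((cylinderDiffeomorph S).injective h)
  inMap_ne_outMap _ _ h := zero_ne_one (congrArg Prod.snd ((cylinderDiffeomorph S).injective h))
  boundary_eq := boundary_cylinder S
  orient_inMap x v w hv := by
    rw [orientSign_cylinder_slice, sign_pos hv]
    simp [iccSign]
  orient_outMap x v w hv := by
    rw [orientSign_cylinder_slice, sign_neg hv]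
    simp [iccSign]

end Cylinder

/-! ### A shift of the half-line that is the identity far away -/

lemma exists_bound_deriv_smoothTransition :
    ∃ C : ℝ, ∀ x, ‖deriv Real.smoothTransition x‖ ≤ C := by
  have deriv_continuous : Continuous (deriv Real.smoothTransition) :=
    (Real.smoothTransition.contDiff (n := 1)).continuous_deriv (by simp)
  refine HasCompactSupport.exists_bound_of_continuous
    (HasCompactSupport.intro (isCompact_Icc (a := (0 : ℝ)) (b := 1)) fun x hx => ?_)
    deriv_continuous
  rcases lt_or_ge x 0 with hx₀ | hx₀
  · have eventually_zero : Real.smoothTransition =ᶠ[𝓝 x] fun _ => 0 := by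
      filter_upwards [gt_mem_nhds hx₀] with y hy
      exact Real.smoothTransition.zero_of_nonpos hy.le
    rw [eventually_zero.deriv_eq, deriv_const]
  · have eventually_one : Real.smoothTransition =ᶠ[𝓝 x] fun _ => 1 := by
      filter_upwards [lt_mem_nhds (not_le.1 fun hx₁ => hx ⟨hx₀, hx₁⟩)] with y hy
      exact Real.smoothTransition.one_of_one_le hy.le
    rw [eventually_one.deriv_eq, deriv_const]

lemma exists_shift_eq_id_of_le : ∃ (σ : ℝ → ℝ) (R : ℝ), 0 ≤ R ∧ ContDiff ℝ ∞ σ ∧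
    (∀ t, 0 < deriv σ t) ∧ (∀ t ≤ 1, σ t = 1 + t) ∧ ∀ t, R ≤ t → σ t = t := by
  obtain ⟨C, hC⟩ := exists_bound_deriv_smoothTransition
  -- Spreading the transition from 1 to 0 over a length `B > C` keeps the derivative positive.
  obtain ⟨B, hB, hCB⟩ : ∃ B, 0 < B ∧ C < B := ⟨|C| + 1, by positivity, by
    linarith [le_abs_self C]⟩
  have hsmooth : ContDiff ℝ ∞ Real.smoothTransition := Real.smoothTransition.contDiff (n := ⊤)
  refine ⟨fun t => t + Real.smoothTransition (1 + (1 - t) / B), 1 + B, by positivity, by fun_prop,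
    fun t => ?_, fun t ht => ?_, fun t ht => ?_⟩
  · have hasDerivAt_argument : HasDerivAt (fun t : ℝ => 1 + (1 - t) / B) (-1 / B) t :=
      (((hasDerivAt_id t).const_sub 1).div_const B).const_add 1
    have hasDerivAt_shift := (hasDerivAt_id' t).fun_add
      (((hsmooth.differentiable (by simp)) (1 + (1 - t) / B)).hasDerivAt.comp t
        hasDerivAt_argument)
    have deriv_lt_one : deriv Real.smoothTransition (1 + (1 - t) / B) / B < 1 :=
      (div_lt_one hB).2 ((le_abs_self _).trans_lt ((hC _).trans_lt hCB))
    refine hasDerivAt_shift.deriv.symm ▸ ?_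
    rw [neg_div, mul_neg, mul_one_div]
    linarith
  · have one_le : (1 : ℝ) ≤ 1 + (1 - t) / B :=
      le_add_of_nonneg_right (div_nonneg (by linarith) hB.le)
    simp only [Real.smoothTransition.one_of_one_le one_le]
    ring
  · have nonpos : 1 + (1 - t) / B ≤ 0 := by
      have : (1 - t) / B ≤ -1 := (div_le_iff₀ hB).2 (by linarith)
      linarith
    simp only [Real.smoothTransition.zero_of_nonpos nonpos, add_zero]

/-! ### The half-line -/

/-- The coordinate of a point of the half-line `[0,∞)`, which is modelled by
`EuclideanHalfSpace 1`. -/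
def halfLineCoord (t : EuclideanHalfSpace 1) : ℝ := t.val 0

/-- The point of the half-line with a given nonnegative coordinate. -/
def halfLineMk (r : ℝ) (h : 0 ≤ r) : EuclideanHalfSpace 1 := ⟨WithLp.toLp 2 fun _ => r, h⟩

@[simp]
lemma halfLineCoord_zero : halfLineCoord 0 = 0 := rfl

lemma halfLineCoord_nonneg (t : EuclideanHalfSpace 1) : 0 ≤ halfLineCoord t := t.2

lemma halfLineCoord_injective : Function.Injective halfLineCoord := by
  intro s t h
  refine Subtype.ext ?_
  ext i
  rw [Subsingleton.elim i 0]
  exact h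

lemma toLp_halfLineCoord (t : EuclideanHalfSpace 1) :
    (WithLp.toLp 2 fun _ => halfLineCoord t : EuclideanSpace ℝ (Fin 1)) = t.val := by
  ext i
  rw [Subsingleton.elim i 0]
  rfl

lemma contMDiff_halfLineCoord : ContMDiff (𝓡∂ 1) 𝓘(ℝ, ℝ) ∞ halfLineCoord := by
  have h : ContDiff ℝ ∞ (fun z : EuclideanSpace ℝ (Fin 1) => z 0) := by fun_prop
  exact h.contMDiff.comp (𝓡∂ 1).contMDiff

section ToHalfLine

variable {E H M : Type*} [NormedAddCommGroup E] [NormedSpace ℝ E] [TopologicalSpace H]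
  [TopologicalSpace M] [ChartedSpace H M] {I : ModelWithCorners ℝ E H}

lemma contDiff_toLp_const :
    ContDiff ℝ ∞ (fun r : ℝ => (WithLp.toLp 2 fun _ => r : EuclideanSpace ℝ (Fin 1))) :=
  contDiff_euclidean.2 fun _ => contDiff_id

lemma contMDiffOn_halfLine {f : M → EuclideanHalfSpace 1} {s : Set M}
    (h : ContMDiffOn I 𝓘(ℝ, ℝ) ∞ (fun x => halfLineCoord (f x)) s) :
    ContMDiffOn I (𝓡∂ 1) ∞ f s := by
  have contMDiffOn_val : ContMDiffOn I 𝓘(ℝ, EuclideanSpace ℝ (Fin 1)) ∞ (fun x => (f x).val) s :=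
    (contDiff_toLp_const.contMDiff.comp_contMDiffOn h).congr fun x _ => (toLp_halfLineCoord _).symm
  exact fun x hx => contMDiffWithinAt_iff_target.2
    ⟨Topology.IsInducing.subtypeVal.continuousWithinAt_iff.2
      (contMDiffOn_val x hx).continuousWithinAt, contMDiffOn_val x hx⟩

lemma contMDiff_halfLine {f : M → EuclideanHalfSpace 1}
    (h : ContMDiff I 𝓘(ℝ, ℝ) ∞ (fun x => halfLineCoord (f x))) :
    ContMDiff I (𝓡∂ 1) ∞ f :=
  contMDiffOn_univ.1 (contMDiffOn_halfLine h.contMDiffOn)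

end ToHalfLine

section Composition

variable {E E' E'' H H' H'' M N P : Type*}
  [NormedAddCommGroup E] [NormedSpace ℝ E] [NormedAddCommGroup E'] [NormedSpace ℝ E']
  [NormedAddCommGroup E''] [NormedSpace ℝ E''] [TopologicalSpace H] [TopologicalSpace H']
  [TopologicalSpace H''] [TopologicalSpace M] [TopologicalSpace N] [TopologicalSpace P]
  [ChartedSpace H M] [ChartedSpace H' N] [ChartedSpace H'' P] {I : ModelWithCorners ℝ E H}
  {I' : ModelWithCorners ℝ E' H'} {I'' : ModelWithCorners ℝ E'' H''} {f : M → N} {g : N → P}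
  {x : M}

lemma mfderiv_injective_of_comp (hg : MDifferentiableAt I' I'' g (f x))
    (hf : MDifferentiableAt I I' f x)
    (h : Function.Injective (mfderiv I I'' (fun y => g (f y)) x)) :
    Function.Injective (mfderiv I I' f x) := by
  rw [show mfderiv I I'' (fun y => g (f y)) x = _ from mfderiv_comp x hg hf] at h
  exact Function.Injective.of_comp h

lemma mfderiv_injective_comp (hg : MDifferentiableAt I' I'' g (f x))
    (hf : MDifferentiableAt I I' f x) (hginj : Function.Injective (mfderiv I' I'' g (f x)))
    (hfinj : Function.Injective (mfderiv I I' f x)) :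
    Function.Injective (mfderiv I I'' (fun y => g (f y)) x) := by
  rw [show mfderiv I I'' (fun y => g (f y)) x = _ from mfderiv_comp x hg hf]
  exact hginj.comp hfinj

end Composition

lemma mfderiv_halfLineCoord_injective (t : EuclideanHalfSpace 1) :
    Function.Injective (mfderiv (𝓡∂ 1) 𝓘(ℝ, ℝ) halfLineCoord t) := by
  refine mfderiv_injective_of_comp (I'' := 𝓘(ℝ, EuclideanSpace ℝ (Fin 1)))
    (g := fun r : ℝ => (WithLp.toLp 2 fun _ => r : EuclideanSpace ℝ (Fin 1)))
    (contDiff_toLp_const.contMDiff.mdifferentiableAt (by simp))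
    (contMDiff_halfLineCoord.mdifferentiableAt (by simp)) ?_
  have toLp_eq_chart :
      (fun t => (WithLp.toLp 2 fun _ => halfLineCoord t : EuclideanSpace ℝ (Fin 1))) =
        extChartAt (𝓡∂ 1) t := funext toLp_halfLineCoord
  rw [toLp_eq_chart]
  exact (isInvertible_mfderiv_extChartAt (mem_extChartAt_source t)).injective

/-- The inclusion of `[0,1]` into `[0,∞)`; it places a cylinder inside a collar. -/
def iccToHalfLine (s : Set.Icc (0 : ℝ) 1) : EuclideanHalfSpace 1 := halfLineMk s.val s.2.1

lemma contMDiff_iccToHalfLine : ContMDiff (𝓡∂ 1) (𝓡∂ 1) ∞ iccToHalfLine :=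
  contMDiff_halfLine contMDiff_subtypeVal_Icc

lemma mfderiv_iccToHalfLine_injective (s : Set.Icc (0 : ℝ) 1) :
    Function.Injective (mfderiv (𝓡∂ 1) (𝓡∂ 1) iccToHalfLine s) := by
  refine mfderiv_injective_of_comp (g := halfLineCoord) (I'' := 𝓘(ℝ, ℝ))
    (contMDiff_halfLineCoord.mdifferentiableAt (by simp))
    (contMDiff_iccToHalfLine.mdifferentiableAt (by simp)) ?_
  have mfderiv_val_one :
      mfderiv (𝓡∂ 1) 𝓘(ℝ, ℝ) (fun s : Set.Icc (0 : ℝ) 1 => s.val) s 1 = (1 : ℝ) :=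
    mfderiv_subtypeVal_Icc_one s
  have one_ne_zero : (1 : TangentSpace (𝓡∂ 1) s) ≠ 0 := by
    intro h
    rw [h, map_zero] at mfderiv_val_one
    exact zero_ne_one (α := ℝ) mfderiv_val_one
  have finrank_eq_one : Module.finrank ℝ (TangentSpace (𝓡∂ 1) s) = 1 :=
    finrank_euclideanSpace_fin (n := 1)
  refine (injective_iff_map_eq_zero _).2 fun v hv => ?_
  obtain ⟨c, rfl⟩ := (finrank_eq_one_iff_of_nonzero' _ one_ne_zero).1 finrank_eq_one v
  have mfderiv_val_smul :
      mfderiv (𝓡∂ 1) 𝓘(ℝ, ℝ) (fun s : Set.Icc (0 : ℝ) 1 => s.val) s (c • 1) = (0 : ℝ) := hv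
  rw [map_smul, mfderiv_val_one] at mfderiv_val_smul
  have c_eq_zero : c = 0 := (mul_one c).symm.trans mfderiv_val_smul
  rw [c_eq_zero, zero_smul]

/-! ### Reparametrizing collars -/

section ProductMaps

variable {E E' E'' H H' H'' S M N : Type*}
  [NormedAddCommGroup E] [NormedSpace ℝ E] [NormedAddCommGroup E'] [NormedSpace ℝ E']
  [NormedAddCommGroup E''] [NormedSpace ℝ E''] [TopologicalSpace H] [TopologicalSpace H']
  [TopologicalSpace H''] [TopologicalSpace S] [TopologicalSpace M] [TopologicalSpace N]
  [ChartedSpace H S] [ChartedSpace H' M] [ChartedSpace H'' N] {I : ModelWithCorners ℝ E H}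
  {J : ModelWithCorners ℝ E' H'} {J' : ModelWithCorners ℝ E'' H''}

variable (S I) in
lemma isLocalDiffeomorph_prodMap_of_inverse {f : M → N} {g : N → M} {U : Set N} (hU : IsOpen U)
    (hf : ContMDiff J J' ∞ f) (hg : ContMDiffOn J' J ∞ g U) (hmaps : ∀ x, f x ∈ U)
    (hleft : ∀ x, g (f x) = x) (hright : ∀ y ∈ U, f (g y) = y) :
    IsLocalDiffeomorph (I.prod J) (I.prod J') ∞ (fun p : S × M => (p.1, f p.2)) := by
  let Φ : PartialDiffeomorph (I.prod J) (I.prod J') (S × M) (S × N) ∞ :=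
    { toFun := fun p => (p.1, f p.2)
      invFun := fun p => (p.1, g p.2)
      source := Set.univ
      target := Set.univ ×ˢ U
      map_source' := fun p _ => ⟨Set.mem_univ _, hmaps _⟩
      map_target' := fun _ _ => Set.mem_univ _
      left_inv' := fun p _ => Prod.ext rfl (hleft _)
      right_inv' := fun p hp => Prod.ext rfl (hright _ hp.2)
      open_source := isOpen_univ
      open_target := isOpen_univ.prod hU
      contMDiffOn_toFun := (contMDiff_fst.prodMk (hf.comp contMDiff_snd)).contMDiffOn
      contMDiffOn_invFun := contMDiff_fst.contMDiffOn.prodMk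
        (hg.comp contMDiff_snd.contMDiffOn fun p hp => hp.2) }
  exact fun p => ⟨Φ, Set.mem_univ _, fun _ _ => rfl⟩

variable (I) in
lemma mfderiv_prodMap_injective {f : M → N} {p : S × M} (hf : MDifferentiableAt J J' f p.2)
    (h : Function.Injective (mfderiv J J' f p.2)) :
    Function.Injective
      (mfderiv (I.prod J) (I.prod J') (fun p : S × M => (p.1, f p.2)) p) := by
  rw [show mfderiv (I.prod J) (I.prod J') (fun p : S × M => (p.1, f p.2)) p =
    (mfderiv I I id p.1).prodMap (mfderiv J J' f p.2) from
      mfderiv_prodMap (mdifferentiableAt_id (x := p.1)) hf, mfderiv_id]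
  exact Function.injective_id.prodMap h

end ProductMaps

/-- The odd diffeomorphism `t ↦ t / √(1 + t²)` from the line to `(-1,1)`, as a partial
homeomorphism so that its inverse is available. -/
abbrev squash : OpenPartialHomeomorph ℝ ℝ := OpenPartialHomeomorph.univUnitBall

lemma squash_apply (t : ℝ) : squash t = (√(1 + ‖t‖ ^ 2))⁻¹ * t := rfl

lemma squash_symm_apply (t : ℝ) : squash.symm t = (√(1 - ‖t‖ ^ 2))⁻¹ * t := rfl

lemma squash_zero : squash 0 = 0 := OpenPartialHomeomorph.univUnitBall_apply_zero

lemma squash_neg (t : ℝ) : squash (-t) = -squash t := by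
  rw [squash_apply, squash_apply, norm_neg, mul_neg]

lemma squash_nonneg {t : ℝ} (h : 0 ≤ t) : 0 ≤ squash t := by
  rw [squash_apply]
  positivity

lemma squash_symm_nonneg {t : ℝ} (h : 0 ≤ t) : 0 ≤ squash.symm t := by
  rw [squash_symm_apply]
  positivity

lemma abs_squash_lt (t : ℝ) : |squash t| < 1 := by
  have := squash.map_source (x := t) (Set.mem_univ _)
  rwa [OpenPartialHomeomorph.univUnitBall_target, mem_ball_zero_iff] at this

lemma squash_symm_squash (t : ℝ) : squash.symm (squash t) = t :=
  squash.left_inv (Set.mem_univ _)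

lemma squash_injective : Function.Injective squash :=
  Function.LeftInverse.injective squash_symm_squash

lemma squash_squash_symm {t : ℝ} (h : |t| < 1) : squash (squash.symm t) = t :=
  squash.right_inv (by rwa [OpenPartialHomeomorph.univUnitBall_target, mem_ball_zero_iff])

lemma contMDiff_squash : ContMDiff 𝓘(ℝ, ℝ) 𝓘(ℝ, ℝ) ∞ squash :=
  OpenPartialHomeomorph.contDiff_univUnitBall.contMDiff

lemma contMDiffOn_squash_symm :
    ContMDiffOn 𝓘(ℝ, ℝ) 𝓘(ℝ, ℝ) ∞ squash.symm {r | |r| < 1} := by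
  refine (OpenPartialHomeomorph.contDiffOn_univUnitBall_symm.contMDiffOn).mono fun r hr => ?_
  rwa [mem_ball_zero_iff]

/-- The map `t ↦ squash t` from `[0,∞)` to itself, which shrinks a collar to one of width `1`. -/
def shrinkHalfLine (t : EuclideanHalfSpace 1) : EuclideanHalfSpace 1 :=
  halfLineMk (squash (halfLineCoord t)) (squash_nonneg (halfLineCoord_nonneg t))

/-- The map `t ↦ 1 - squash t` from `[0,∞)` to `[0,1]`, a collar of the end `1` of the interval. -/
def halfLineToIcc (t : EuclideanHalfSpace 1) : Set.Icc (0 : ℝ) 1 :=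
  ⟨1 - squash (halfLineCoord t), sub_nonneg.2 (abs_lt.1 (abs_squash_lt _)).2.le,
    sub_le_self _ (squash_nonneg (halfLineCoord_nonneg t))⟩

/-- The map `t ↦ 1 + squash t` from `ℝ` to `[0,∞)`, a bicollar of the point `1` of the half-line. -/
def lineToHalfLine (t : ℝ) : EuclideanHalfSpace 1 :=
  halfLineMk (1 + squash t) (by linarith [(abs_lt.1 (abs_squash_lt t)).1])

lemma halfLineToIcc_zero : halfLineToIcc 0 = 1 := by
  refine Subtype.ext ?_
  change 1 - squash 0 = 1
  rw [squash_zero, sub_zero]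

lemma shrinkHalfLine_zero : shrinkHalfLine 0 = 0 :=
  halfLineCoord_injective squash_zero

lemma halfLineToIcc_injective : Function.Injective halfLineToIcc := fun _ _ h =>
  halfLineCoord_injective (squash_injective (sub_right_injective (congrArg Subtype.val h)))

lemma shrinkHalfLine_injective : Function.Injective shrinkHalfLine := fun _ _ h =>
  halfLineCoord_injective (squash_injective (congrArg halfLineCoord h))

section Collars

variable {E H S : Type*} [NormedAddCommGroup E] [NormedSpace ℝ E] [TopologicalSpace H]
  [TopologicalSpace S] [ChartedSpace H S] {I : ModelWithCorners ℝ E H}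

lemma isLocalDiffeomorph_shrinkHalfLine :
    IsLocalDiffeomorph (I.prod (𝓡∂ 1)) (I.prod (𝓡∂ 1)) ∞
      (fun p : S × EuclideanHalfSpace 1 => (p.1, shrinkHalfLine p.2)) := by
  refine isLocalDiffeomorph_prodMap_of_inverse S I (f := shrinkHalfLine)
    (g := fun r => halfLineMk (squash.symm (halfLineCoord r))
      (squash_symm_nonneg (halfLineCoord_nonneg r)))
    (U := {r | |halfLineCoord r| < 1})
    (isOpen_lt contMDiff_halfLineCoord.continuous.abs continuous_const)
    (contMDiff_halfLine (contMDiff_squash.comp contMDiff_halfLineCoord))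
    (contMDiffOn_halfLine (contMDiffOn_squash_symm.comp contMDiff_halfLineCoord.contMDiffOn
      fun r hr => hr))
    (fun t => abs_squash_lt _) (fun t => halfLineCoord_injective ?_)
    fun r hr => halfLineCoord_injective ?_
  · exact squash_symm_squash _
  · exact squash_squash_symm hr

lemma isLocalDiffeomorph_lineToHalfLine :
    IsLocalDiffeomorph (I.prod 𝓘(ℝ, ℝ)) (I.prod (𝓡∂ 1)) ∞
      (fun p : S × ℝ => (p.1, lineToHalfLine p.2)) := by
  have contMDiff_coord_sub_one : ContMDiff (𝓡∂ 1) 𝓘(ℝ, ℝ) ∞ (fun r => halfLineCoord r - 1) :=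
    contMDiff_halfLineCoord.sub contMDiff_const
  refine isLocalDiffeomorph_prodMap_of_inverse S I (f := lineToHalfLine)
    (g := fun r => squash.symm (halfLineCoord r - 1))
    (U := {r | |halfLineCoord r - 1| < 1})
    (isOpen_lt contMDiff_coord_sub_one.continuous.abs continuous_const)
    (contMDiff_halfLine (contMDiff_const.add contMDiff_squash))
    (contMDiffOn_squash_symm.comp contMDiff_coord_sub_one.contMDiffOn fun r hr => hr)
    (fun t => ?_) (fun t => ?_) fun r hr => halfLineCoord_injective ?_
  · change |1 + squash t - 1| < 1
    rw [add_sub_cancel_left]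
    exact abs_squash_lt _
  · change squash.symm (1 + squash t - 1) = t
    rw [add_sub_cancel_left]
    exact squash_symm_squash _
  · change 1 + squash (squash.symm (halfLineCoord r - 1)) = halfLineCoord r
    rw [squash_squash_symm hr, add_sub_cancel]

lemma isLocalDiffeomorph_halfLineToIcc :
    IsLocalDiffeomorph (I.prod (𝓡∂ 1)) (I.prod (𝓡∂ 1)) ∞
      (fun p : S × EuclideanHalfSpace 1 => (p.1, halfLineToIcc p.2)) := by
  have contMDiff_one_sub_val :
      ContMDiff (𝓡∂ 1) 𝓘(ℝ, ℝ) ∞ (fun r : Set.Icc (0 : ℝ) 1 => 1 - r.val) :=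
    contMDiff_const.sub contMDiff_subtypeVal_Icc
  have contMDiff_one_sub_squash :
      ContMDiff (𝓡∂ 1) 𝓘(ℝ, ℝ) ∞ (fun t => 1 - squash (halfLineCoord t)) :=
    contMDiff_const.sub (contMDiff_squash.comp contMDiff_halfLineCoord)
  refine isLocalDiffeomorph_prodMap_of_inverse S I (f := halfLineToIcc)
    (g := fun r => halfLineMk (squash.symm (1 - r.val)) (squash_symm_nonneg (sub_nonneg.2 r.2.2)))
    (U := {r | |1 - r.val| < 1})
    (isOpen_lt contMDiff_one_sub_val.continuous.abs continuous_const)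
    (contMDiff_iff_comp_subtypeVal_Icc.2
      ⟨contMDiff_one_sub_squash.continuous.subtype_mk _, contMDiff_one_sub_squash⟩)
    (contMDiffOn_halfLine
      (contMDiffOn_squash_symm.comp contMDiff_one_sub_val.contMDiffOn fun r hr => hr))
    (fun t => ?_) (fun t => halfLineCoord_injective ?_) fun r hr => Subtype.ext ?_
  · change |1 - (1 - squash (halfLineCoord t))| < 1
    rw [sub_sub_cancel]
    exact abs_squash_lt _
  · change squash.symm (1 - (1 - squash (halfLineCoord t))) = _
    rw [sub_sub_cancel]
    exact squash_symm_squash _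
  · change 1 - squash (squash.symm (1 - r.val)) = r.val
    rw [squash_squash_symm hr, sub_sub_cancel]

end Collars

/-! ### Differentials at boundary points -/

lemma linearForm_pos_of_nonneg {V : Type*} [AddCommGroup V] [Module ℝ V] {ℓ φ : V →ₗ[ℝ] ℝ}
    (hφ : Function.Surjective φ) (h : ∀ w, 0 ≤ ℓ w → 0 ≤ φ w) {v : V} (hv : 0 < ℓ v) :
    0 < φ v := by
  obtain ⟨w, hw⟩ := hφ (-1)
  have nonneg := h (w + (-ℓ w / ℓ v) • v) (by
    rw [map_add, map_smul, smul_eq_mul, div_mul_cancel₀ _ hv.ne', add_neg_cancel])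
  rw [map_add, map_smul, hw, smul_eq_mul] at nonneg
  refine (h v hv.le).lt_of_ne fun hφv => ?_
  rw [← hφv, mul_zero] at nonneg
  linarith

section Boundary

variable {d : ℕ} {P Q : ManifoldWithBoundary d}

lemma extChartAt_apply_zero_of_isBoundaryPoint {p : P} (hp : (𝓡∂ (d + 1)).IsBoundaryPoint p) :
    (show EuclideanSpace ℝ (Fin (d + 1)) from extChartAt (𝓡∂ (d + 1)) p p) 0 = 0 := by
  rw [ModelWithCorners.isBoundaryPoint_iff,
    frontier_range_modelWithCornersEuclideanHalfSpace] at hp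
  exact hp.symm

lemma mfderiv_apply_zero_nonneg {g : P → Q} {p : P}
    (hg : MDifferentiableAt (𝓡∂ (d + 1)) (𝓡∂ (d + 1)) g p)
    (hp : (𝓡∂ (d + 1)).IsBoundaryPoint p) (hgp : (𝓡∂ (d + 1)).IsBoundaryPoint (g p))
    {v : EuclideanSpace ℝ (Fin (d + 1))} (hv : 0 ≤ v 0) :
    0 ≤ (show EuclideanSpace ℝ (Fin (d + 1)) from
      mfderiv (𝓡∂ (d + 1)) (𝓡∂ (d + 1)) g p v) 0 := by
  let coord : EuclideanSpace ℝ (Fin (d + 1)) →L[ℝ] ℝ := EuclideanSpace.proj 0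
  have hasFDerivWithinAt_coord :=
    coord.hasFDerivAt.comp_hasFDerivWithinAt _ hg.hasMFDerivAt.2
  -- The first coordinate of `g` vanishes at the boundary point `p`, so it is minimal there.
  have isLocalMinOn_coord :
      IsLocalMinOn (coord ∘ writtenInExtChartAt (𝓡∂ (d + 1)) (𝓡∂ (d + 1)) p g)
        (Set.range (𝓡∂ (d + 1))) (extChartAt (𝓡∂ (d + 1)) p p) := by
    refine Filter.Eventually.of_forall fun z => ?_
    have coord_eq_zero : coord (writtenInExtChartAt (𝓡∂ (d + 1)) (𝓡∂ (d + 1)) p g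
        (extChartAt (𝓡∂ (d + 1)) p p)) = 0 := by
      rw [writtenInExtChartAt, Function.comp_apply, Function.comp_apply, extChartAt_to_inv]
      exact extChartAt_apply_zero_of_isBoundaryPoint hgp
    exact coord_eq_zero.trans_le (chartAt (EuclideanHalfSpace (d + 1)) (g p) _).2
  refine isLocalMinOn_coord.hasFDerivWithinAt_nonneg hasFDerivWithinAt_coord (y := v)
    (mem_posTangentConeAt_of_segment_subset
      ((𝓡∂ (d + 1)).convex_range.segment_subset (Set.mem_range_self _) ?_))
  rw [range_modelWithCornersEuclideanHalfSpace]
  change 0 ≤ (extChartAt (𝓡∂ (d + 1)) p p + v) 0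
  rw [PiLp.add_apply]
  exact hv.trans_eq ((zero_add _).symm.trans
    (congrArg (· + v 0) (extChartAt_apply_zero_of_isBoundaryPoint hp).symm))

lemma IsInward.mfderiv_apply {g : P → Q} {p : P}
    (hg : MDifferentiableAt (𝓡∂ (d + 1)) (𝓡∂ (d + 1)) g p)
    (hp : (𝓡∂ (d + 1)).IsBoundaryPoint p) (hgp : (𝓡∂ (d + 1)).IsBoundaryPoint (g p))
    (hinj : Function.Injective (mfderiv (𝓡∂ (d + 1)) (𝓡∂ (d + 1)) g p))
    {v : TangentSpace (𝓡∂ (d + 1)) p} (hv : IsInward p v) :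
    IsInward (g p) (mfderiv (𝓡∂ (d + 1)) (𝓡∂ (d + 1)) g p v) := by
  let coord : EuclideanSpace ℝ (Fin (d + 1)) →ₗ[ℝ] ℝ := EuclideanSpace.projₗ 0
  let D : EuclideanSpace ℝ (Fin (d + 1)) →L[ℝ] EuclideanSpace ℝ (Fin (d + 1)) :=
    mfderiv (𝓡∂ (d + 1)) (𝓡∂ (d + 1)) g p
  have surjective_D : Function.Surjective D :=
    LinearMap.injective_iff_surjective (f := D.toLinearMap).1 hinj
  have surjective_coord : Function.Surjective coord := fun r =>
    ⟨EuclideanSpace.single 0 r, by simp [coord]⟩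
  exact linearForm_pos_of_nonneg (ℓ := coord) (φ := coord ∘ₗ D.toLinearMap)
    (surjective_coord.comp surjective_D) (fun w hw => mfderiv_apply_zero_nonneg hg hp hgp hw) hv

end Boundary

/-! ### Pushing a manifold off its boundary along a collar -/

/-- `s` embeds the half-line `[0,∞)` onto `[1,∞)`, as `t ↦ 1 + t` for `t ≤ 1` and as the identity
for `t ≥ R`. Applied in a collar, it makes room for a cylinder. -/
structure IsHalfLineShift (s : EuclideanHalfSpace 1 → EuclideanHalfSpace 1) (R : ℝ) : Prop where
  contMDiff : ContMDiff (𝓡∂ 1) (𝓡∂ 1) ∞ s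
  mfderiv_injective : ∀ t, Function.Injective (mfderiv (𝓡∂ 1) (𝓡∂ 1) s t)
  injective : Function.Injective s
  halfLineCoord_eq_one_add : ∀ t, halfLineCoord t ≤ 1 → halfLineCoord (s t) = 1 + halfLineCoord t
  eq_self : ∀ t, R ≤ halfLineCoord t → s t = t
  range_eq : Set.range s = {t | 1 ≤ halfLineCoord t}

lemma mfderiv_halfLine_injective_of_deriv_ne_zero
    {s : EuclideanHalfSpace 1 → EuclideanHalfSpace 1} {σ : ℝ → ℝ} {t : EuclideanHalfSpace 1}
    (hs : MDifferentiableAt (𝓡∂ 1) (𝓡∂ 1) s t) (hσ : DifferentiableAt ℝ σ (halfLineCoord t))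
    (hcoord : ∀ r, halfLineCoord (s r) = σ (halfLineCoord r))
    (hderiv : deriv σ (halfLineCoord t) ≠ 0) :
    Function.Injective (mfderiv (𝓡∂ 1) (𝓡∂ 1) s t) := by
  refine mfderiv_injective_of_comp (g := halfLineCoord) (I'' := 𝓘(ℝ, ℝ))
    (contMDiff_halfLineCoord.mdifferentiableAt (by simp)) hs ?_
  rw [funext hcoord]
  refine mfderiv_injective_comp hσ.mdifferentiableAt
    (contMDiff_halfLineCoord.mdifferentiableAt (by simp)) ?_ (mfderiv_halfLineCoord_injective t)
  rw [mfderiv_eq_fderiv]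
  refine (injective_iff_map_eq_zero _).2 fun v hv => ?_
  have fderiv_apply (v : ℝ) :
      fderiv ℝ σ (halfLineCoord t) v = v * deriv σ (halfLineCoord t) := by
    rw [fderiv_eq_smul_deriv, smul_eq_mul]
  exact (mul_eq_zero.1 ((fderiv_apply v).symm.trans hv)).resolve_right hderiv

lemma exists_isHalfLineShift : ∃ s R, IsHalfLineShift s R := by
  obtain ⟨σ, R, hR, hσ, hpos, hsmall, hlarge⟩ := exists_shift_eq_id_of_le
  have hmono : StrictMono σ := strictMono_of_deriv_pos hpos
  have hzero : σ 0 = 1 := by rw [hsmall 0 zero_le_one, add_zero]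
  have one_le (t : EuclideanHalfSpace 1) : 1 ≤ σ (halfLineCoord t) :=
    hzero ▸ hmono.monotone (halfLineCoord_nonneg t)
  let s (t : EuclideanHalfSpace 1) : EuclideanHalfSpace 1 :=
    halfLineMk (σ (halfLineCoord t)) (zero_le_one.trans (one_le t))
  have hs : ContMDiff (𝓡∂ 1) (𝓡∂ 1) ∞ s :=
    contMDiff_halfLine (hσ.contMDiff.comp contMDiff_halfLineCoord)
  refine ⟨s, R, hs,
    fun t => mfderiv_halfLine_injective_of_deriv_ne_zero (hs.mdifferentiableAt (by simp))
      ((hσ.differentiable (by simp)) _) (fun _ => rfl) (hpos _).ne',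
    fun t t' h => halfLineCoord_injective (hmono.injective (congrArg halfLineCoord h)),
    fun t ht => hsmall _ ht, fun t ht => halfLineCoord_injective (hlarge _ ht),
    Set.Subset.antisymm (Set.range_subset_iff.2 one_le) fun t ht => ?_⟩
  obtain ⟨r, hr, hσr⟩ : halfLineCoord t ∈ σ '' Set.Icc 0 (max R (halfLineCoord t)) := by
    refine intermediate_value_Icc (hR.trans (le_max_left _ _)) hσ.continuous.continuousOn ?_
    rw [hzero, hlarge _ (le_max_left _ _)]
    exact ⟨ht, le_max_right _ _⟩
  exact ⟨halfLineMk r hr.1, halfLineCoord_injective hσr⟩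

lemma IsHalfLineShift.halfLineCoord_zero {s : EuclideanHalfSpace 1 → EuclideanHalfSpace 1} {R : ℝ}
    (hs : IsHalfLineShift s R) : halfLineCoord (s 0) = 1 :=
  (hs.halfLineCoord_eq_one_add 0 zero_le_one).trans (add_zero 1)

lemma isCompact_halfLineCoord_le (R : ℝ) : IsCompact {t | halfLineCoord t ≤ R} := by
  have hcont : Continuous fun r : Set.Icc (0 : ℝ) R => halfLineMk r.val r.2.1 :=
    (contDiff_toLp_const.continuous.comp continuous_subtype_val).subtype_mk _
  have eq_range : {t | halfLineCoord t ≤ R} = Set.range fun r : Set.Icc (0 : ℝ) R =>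
      halfLineMk r.val r.2.1 := Set.Subset.antisymm
    (fun t ht => ⟨⟨halfLineCoord t, halfLineCoord_nonneg t, ht⟩, halfLineCoord_injective rfl⟩)
    (Set.range_subset_iff.2 fun r => r.2.2)
  rw [eq_range]
  exact isCompact_range hcont

section LocalDiffeomorph

variable {E E' E'' H H' H'' M N P : Type*}
  [NormedAddCommGroup E] [NormedSpace ℝ E] [NormedAddCommGroup E'] [NormedSpace ℝ E']
  [NormedAddCommGroup E''] [NormedSpace ℝ E''] [TopologicalSpace H] [TopologicalSpace H']
  [TopologicalSpace H''] [TopologicalSpace M] [TopologicalSpace N] [TopologicalSpace P]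
  [ChartedSpace H M] [ChartedSpace H' N] [ChartedSpace H'' P] {I : ModelWithCorners ℝ E H}
  {I' : ModelWithCorners ℝ E' H'} {I'' : ModelWithCorners ℝ E'' H''} {c : M → N} {j : N → P}
  {q : M}

lemma contMDiffAt_of_comp_isLocalDiffeomorphAt (hc : IsLocalDiffeomorphAt I I' ∞ c q)
    (h : ContMDiffAt I I'' ∞ (fun x => j (c x)) q) : ContMDiffAt I' I'' ∞ j (c q) := by
  have symm_apply : hc.localInverse (c q) = q :=
    hc.localInverse_left_inv hc.localInverse_mem_target
  refine ContMDiffAt.congr_of_eventuallyEq (f := fun y => j (c (hc.localInverse y)))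
    (ContMDiffAt.comp (g := fun x => j (c x)) _ (by rwa [symm_apply])
      hc.localInverse_contMDiffAt) ?_
  filter_upwards [hc.localInverse_eventuallyEq_right] with y hy
  exact congrArg j hy.symm

lemma mfderiv_bijective_of_isLocalDiffeomorphAt (hc : IsLocalDiffeomorphAt I I' ∞ c q) :
    Function.Bijective (mfderiv I I' c q) := by
  rw [← hc.mfderivToContinuousLinearEquiv_coe (by simp)]
  exact (hc.mfderivToContinuousLinearEquiv (by simp)).bijective

lemma mfderiv_injective_of_comp_isLocalDiffeomorphAt
    (hc : IsLocalDiffeomorphAt I I' ∞ c q) (hj : MDifferentiableAt I' I'' j (c q))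
    (h : Function.Injective (mfderiv I I'' (fun x => j (c x)) q)) :
    Function.Injective (mfderiv I' I'' j (c q)) := by
  rw [show mfderiv I I'' (fun x => j (c x)) q = (mfderiv I' I'' j (c q)).comp _ from
    mfderiv_comp q hj (hc.mdifferentiableAt (by simp))] at h
  exact Function.Injective.of_comp_right h (mfderiv_bijective_of_isLocalDiffeomorphAt hc).2

end LocalDiffeomorph

section Push

variable {d : ℕ} {S : ClosedManifold d} {W : ManifoldWithBoundary d} {j : W → W} {p : W}

lemma mfderiv_eq_id_of_eventually_eq_self (h : ∀ᶠ q in 𝓝 p, j q = q) :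
    mfderiv (𝓡∂ (d + 1)) (𝓡∂ (d + 1)) j p =
      ContinuousLinearMap.id ℝ (EuclideanSpace ℝ (Fin (d + 1))) :=
  (Filter.EventuallyEq.mfderiv_eq (f := fun q : W => q) h).trans mfderiv_id

lemma preservesOrientationAt_of_eventually_eq_self (h : ∀ᶠ q in 𝓝 p, j q = q) :
    PreservesOrientationAt W W j p := fun v =>
  congrArg₂ (frameSign W) h.self_of_nhds (congrArg
    (fun (A : EuclideanSpace ℝ (Fin (d + 1)) →L[ℝ] EuclideanSpace ℝ (Fin (d + 1))) i => A (v i))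
    (mfderiv_eq_id_of_eventually_eq_self h))

/-- The self-map of `W` that is `(x, t) ↦ (x, s t)` in the collar `c` and the identity off it. -/
def collarPush (c : S × EuclideanHalfSpace 1 → W)
    (s : EuclideanHalfSpace 1 → EuclideanHalfSpace 1) : W → W :=
  Function.extend c (fun q => c (q.1, s q.2)) id

variable {c : S × EuclideanHalfSpace 1 → W} {s : EuclideanHalfSpace 1 → EuclideanHalfSpace 1}
  {R : ℝ}

lemma collarPush_apply (hinj : Function.Injective c) (q : S × EuclideanHalfSpace 1) :
    collarPush c s (c q) = c (q.1, s q.2) :=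
  hinj.extend_apply _ _ q

lemma collarPush_of_notMem_range (hp : p ∉ Set.range c) : collarPush c s p = p :=
  Function.extend_apply' _ _ _ hp

lemma collarPush_mem_range_iff (hinj : Function.Injective c) :
    collarPush c s p ∈ Set.range c ↔ p ∈ Set.range c := by
  constructor
  · intro h
    by_contra hp
    exact hp (collarPush_of_notMem_range hp ▸ h)
  · rintro ⟨q, rfl⟩
    exact ⟨_, (collarPush_apply hinj q).symm⟩

lemma collarPush_injective (hinj : Function.Injective c) (hs : IsHalfLineShift s R) :
    Function.Injective (collarPush c s) := by
  intro p q h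
  have mem_range_iff : p ∈ Set.range c ↔ q ∈ Set.range c := by
    rw [← collarPush_mem_range_iff (s := s) hinj, h, collarPush_mem_range_iff hinj]
  by_cases hp : p ∈ Set.range c
  · obtain ⟨q, rfl⟩ := mem_range_iff.1 hp
    obtain ⟨p, rfl⟩ := hp
    rw [collarPush_apply hinj, collarPush_apply hinj] at h
    obtain ⟨hfst, hsnd⟩ := Prod.mk.inj (hinj h)
    exact congrArg c (Prod.ext hfst (hs.injective hsnd))
  · rwa [collarPush_of_notMem_range hp, collarPush_of_notMem_range (mt mem_range_iff.2 hp)] at h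

lemma eventually_collarPush_eq_self (hc : Continuous c) (hinj : Function.Injective c)
    (hs : IsHalfLineShift s R) (hp : p ∉ c '' (Set.univ ×ˢ {t | halfLineCoord t ≤ R})) :
    ∀ᶠ q in 𝓝 p, collarPush c s q = q := by
  have isClosed_core : IsClosed (c '' (Set.univ ×ˢ {t | halfLineCoord t ≤ R})) :=
    ((isCompact_univ.prod (isCompact_halfLineCoord_le R)).image hc).isClosed
  filter_upwards [isClosed_core.isOpen_compl.mem_nhds hp] with y hy
  by_cases hrange : y ∈ Set.range c
  · obtain ⟨q, rfl⟩ := hrange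
    have hq : R ≤ halfLineCoord q.2 := (not_le.1 fun h => hy ⟨q, ⟨trivial, h⟩, rfl⟩).le
    rw [collarPush_apply hinj, hs.eq_self _ hq]
  · exact collarPush_of_notMem_range hrange

lemma contMDiff_collarPush (hc : IsLocalDiffeomorph ((𝓡 d).prod (𝓡∂ 1)) (𝓡∂ (d + 1)) ∞ c)
    (hinj : Function.Injective c) (hs : IsHalfLineShift s R) :
    ContMDiff (𝓡∂ (d + 1)) (𝓡∂ (d + 1)) ∞ (collarPush c s) := fun p => by
  by_cases hp : p ∈ c '' (Set.univ ×ˢ {t | halfLineCoord t ≤ R})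
  · obtain ⟨q, -, rfl⟩ := hp
    have contMDiff_comp : ContMDiff ((𝓡 d).prod (𝓡∂ 1)) (𝓡∂ (d + 1)) ∞
        (fun q => collarPush c s (c q)) :=
      (hc.contMDiff.comp (contMDiff_id.prodMap hs.contMDiff)).congr (collarPush_apply hinj)
    exact contMDiffAt_of_comp_isLocalDiffeomorphAt (hc q) (contMDiff_comp q)
  · exact contMDiffAt_id.congr_of_eventuallyEq
      (eventually_collarPush_eq_self hc.contMDiff.continuous hinj hs hp)

lemma mfderiv_collarPush_injective
    (hc : IsLocalDiffeomorph ((𝓡 d).prod (𝓡∂ 1)) (𝓡∂ (d + 1)) ∞ c)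
    (hinj : Function.Injective c) (hs : IsHalfLineShift s R) (p : W) :
    Function.Injective (mfderiv (𝓡∂ (d + 1)) (𝓡∂ (d + 1)) (collarPush c s) p) := by
  by_cases hp : p ∈ c '' (Set.univ ×ˢ {t | halfLineCoord t ≤ R})
  · obtain ⟨q, -, rfl⟩ := hp
    refine mfderiv_injective_of_comp_isLocalDiffeomorphAt (hc q)
      ((contMDiff_collarPush hc hinj hs).mdifferentiableAt (by simp)) ?_
    rw [funext (collarPush_apply (s := s) hinj)]
    exact mfderiv_injective_comp (g := c) (f := fun q : S × EuclideanHalfSpace 1 => (q.1, s q.2))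
      (hc.contMDiff.mdifferentiableAt (by simp))
      ((contMDiff_id.prodMap hs.contMDiff).mdifferentiableAt (by simp))
      (mfderiv_bijective_of_isLocalDiffeomorphAt (hc _)).1
      (mfderiv_prodMap_injective (𝓡 d) (hs.contMDiff.mdifferentiableAt (by simp))
        (hs.mfderiv_injective q.2))
  · rw [mfderiv_eq_id_of_eventually_eq_self
      (eventually_collarPush_eq_self hc.contMDiff.continuous hinj hs hp)]
    exact Function.injective_id

lemma orientationPreserving_collarPush
    (hc : IsLocalDiffeomorph ((𝓡 d).prod (𝓡∂ 1)) (𝓡∂ (d + 1)) ∞ c)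
    (hinj : Function.Injective c) (hs : IsHalfLineShift s R) :
    OrientationPreserving W W (collarPush c s) := by
  have hclopen := isClopen_preservesOrientationAt (contMDiff_collarPush hc hinj hs)
    (mfderiv_collarPush_injective hc hinj hs)
  have preserves_of_notMem {p : W} (hp : p ∉ c '' (Set.univ ×ˢ {t | halfLineCoord t ≤ R})) :
      PreservesOrientationAt W W (collarPush c s) p :=
    preservesOrientationAt_of_eventually_eq_self
      (eventually_collarPush_eq_self hc.contMDiff.continuous hinj hs hp)
  refine ⟨contMDiff_collarPush hc hinj hs, fun p => ?_⟩
  by_cases hp : p ∈ c '' (Set.univ ×ˢ {t | halfLineCoord t ≤ R})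
  · -- The collar line `{x} × [0,∞)` is connected, and the push is the identity at its far end.
    obtain ⟨⟨x, t⟩, -, rfl⟩ := hp
    have continuous_line : Continuous fun t : EuclideanHalfSpace 1 => c (x, t) :=
      hc.contMDiff.continuous.comp (continuous_const.prodMk continuous_id)
    have preserves_far : PreservesOrientationAt W W (collarPush c s)
        (c (x, halfLineMk (max R 0 + 1) (by positivity))) := by
      refine preserves_of_notMem ?_
      rintro ⟨q, ⟨-, hq⟩, hcq⟩
      rw [hinj hcq] at hq
      exact absurd hq (not_le.2 ((le_max_left R 0).trans_lt (lt_add_one _)))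
    exact ((hclopen.preimage continuous_line).eq_univ ⟨_, preserves_far⟩).ge (Set.mem_univ t)
  · exact preserves_of_notMem hp

end Push

/-! ### Gluing a cylinder to a collared boundary -/

section CylinderGluing

variable {d : ℕ} {S U : ClosedManifold d} {W : ManifoldWithBoundary d} {N : Cobordism S U}

section CollarInclusion

variable {c : S × EuclideanHalfSpace 1 → W}

/-- The embedding of the cylinder as the part `S × [0,1]` of a collar. -/
def collarInclusion (c : S × EuclideanHalfSpace 1 → W) (p : (cylinder S).bulk) : W :=
  c (((cylinderDiffeomorph S).symm p).1, iccToHalfLine ((cylinderDiffeomorph S).symm p).2)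

lemma collarInclusion_injective (hinj : Function.Injective c) :
    Function.Injective (collarInclusion c) := fun _ _ h =>
  have ⟨hfst, hsnd⟩ := Prod.mk.inj (hinj h)
  (cylinderDiffeomorph S).symm.injective
    (Prod.ext hfst (Subtype.ext (congrArg halfLineCoord hsnd)))

lemma contMDiff_collarInclusion
    (hc : IsLocalDiffeomorph ((𝓡 d).prod (𝓡∂ 1)) (𝓡∂ (d + 1)) ∞ c) :
    ContMDiff (𝓡∂ (d + 1)) (𝓡∂ (d + 1)) ∞ (collarInclusion c) :=
  hc.contMDiff.comp
    ((contMDiff_id.prodMap contMDiff_iccToHalfLine).comp (cylinderDiffeomorph S).symm.contMDiff)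

lemma mfderiv_collarInclusion_injective
    (hc : IsLocalDiffeomorph ((𝓡 d).prod (𝓡∂ 1)) (𝓡∂ (d + 1)) ∞ c) (p : (cylinder S).bulk) :
    Function.Injective (mfderiv (𝓡∂ (d + 1)) (𝓡∂ (d + 1)) (collarInclusion c) p) := by
  have contMDiff_inclusion : ContMDiff ((𝓡 d).prod (𝓡∂ 1)) ((𝓡 d).prod (𝓡∂ 1)) ∞
      (fun q : S × Set.Icc (0 : ℝ) 1 => (q.1, iccToHalfLine q.2)) :=
    contMDiff_id.prodMap contMDiff_iccToHalfLine
  have contMDiff_symm := (cylinderDiffeomorph S).symm.contMDiff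
  refine mfderiv_injective_comp (g := c)
    (hc.contMDiff.mdifferentiableAt (by simp))
    ((contMDiff_inclusion.comp contMDiff_symm).mdifferentiableAt (by simp))
    (mfderiv_bijective_of_isLocalDiffeomorphAt (hc _)).1 ?_
  exact mfderiv_injective_comp
    (contMDiff_inclusion.mdifferentiableAt (by simp)) (contMDiff_symm.mdifferentiableAt (by simp))
    (mfderiv_prodMap_injective (𝓡 d) (contMDiff_iccToHalfLine.mdifferentiableAt (by simp))
      (mfderiv_iccToHalfLine_injective _))
    (mfderiv_bijective_of_isLocalDiffeomorphAt
      ((cylinderDiffeomorph S).symm.isLocalDiffeomorph p)).1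

end CollarInclusion

lemma Cobordism.isBoundaryPoint_inMap (N : Cobordism S U) (x : S) :
    (𝓡∂ (d + 1)).IsBoundaryPoint (N.inMap x) :=
  N.boundary_eq.ge (Or.inl ⟨x, rfl⟩)

lemma Cobordism.isBoundaryPoint_outMap (N : Cobordism S U) (y : U) :
    (𝓡∂ (d + 1)).IsBoundaryPoint (N.outMap y) :=
  N.boundary_eq.ge (Or.inr ⟨y, rfl⟩)

variable {c : S × EuclideanHalfSpace 1 → N.bulk}

lemma collarInclusion_inMap (hc : IsCollar N.inMap c) (x : S) :
    collarInclusion c ((cylinder S).inMap x) = N.inMap x :=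
  (congrArg (fun t => c (x, t)) (halfLineCoord_injective rfl)).trans (hc.2.2 x)

lemma mfderiv_collarInclusion_inMap (hc : IsCollar N.inMap c) (x : S)
    (w : EuclideanSpace ℝ (Fin d)) :
    mfderiv (𝓡∂ (d + 1)) (𝓡∂ (d + 1)) (collarInclusion c) ((cylinder S).inMap x)
      (mfderiv (𝓡 d) (𝓡∂ (d + 1)) (cylinder S).inMap x w) =
        mfderiv (𝓡 d) (𝓡∂ (d + 1)) N.inMap x w := by
  have hcomp := mfderiv_comp_apply (I' := 𝓡∂ (d + 1)) x
    ((contMDiff_collarInclusion hc.1).mdifferentiableAt (x := (cylinder S).inMap x) (by simp))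
    ((cylinder S).contMDiff_inMap.mdifferentiableAt (by simp)) w
  rw [show collarInclusion c ∘ (cylinder S).inMap = N.inMap from
    funext (collarInclusion_inMap hc)] at hcomp
  exact hcomp.symm

lemma preservesOrientationAt_collarInclusion_inMap (hc : IsCollar N.inMap c) (x : S) :
    PreservesOrientationAt (cylinder S).bulk N.bulk (collarInclusion c)
      ((cylinder S).inMap x) := by
  let p := (cylinder S).inMap x
  obtain ⟨v, hv⟩ : ∃ v : TangentSpace (𝓡∂ (d + 1)) p, IsInward p v :=
    ⟨EuclideanSpace.single (0 : Fin (d + 1)) (1 : ℝ), by simp [IsInward]⟩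
  let D : EuclideanSpace ℝ (Fin (d + 1)) →L[ℝ] EuclideanSpace ℝ (Fin (d + 1)) :=
    mfderiv (𝓡∂ (d + 1)) (𝓡∂ (d + 1)) (collarInclusion c) p
  have inward_image : IsInward (N.inMap x) (D v) := by
    have hgp := N.isBoundaryPoint_inMap x
    rw [← collarInclusion_inMap hc x] at hgp
    exact hv.mfderiv_apply ((contMDiff_collarInclusion hc.1).mdifferentiableAt (by simp))
      ((cylinder S).isBoundaryPoint_inMap x) hgp (mfderiv_collarInclusion_injective hc.1 p)
  -- Test on a frame of an inward vector and a frame of `S`, as both in-boundaries reverse alike.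
  have frameSign_source := (cylinder S).orient_inMap x v (stdBasis d) hv
  have frameSign_target := N.orient_inMap x (D v) (stdBasis d) inward_image
  refine PreservesOrientationAt.of_frameSign_eq (v₀ := Matrix.vecCons v fun i =>
    mfderiv (𝓡 d) (𝓡∂ (d + 1)) (cylinder S).inMap x (stdBasis d i))
    (fun h => frameSign_stdBasis_ne_zero x (frameSign_source.symm.trans h))
    (Eq.trans ?_ (frameSign_target.trans frameSign_source.symm))
  refine congrArg₂ (frameSign N.bulk) (collarInclusion_inMap hc x) (funext fun i => ?_)
  refine Fin.cases rfl (fun i => ?_) i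
  exact mfderiv_collarInclusion_inMap hc x (stdBasis d i)

lemma orientationPreserving_collarInclusion (hc : IsCollar N.inMap c) :
    OrientationPreserving (cylinder S).bulk N.bulk (collarInclusion c) := by
  refine ⟨contMDiff_collarInclusion hc.1, fun p => ?_⟩
  obtain ⟨⟨x, t⟩, rfl⟩ := (cylinderDiffeomorph S).surjective p
  have hclopen := isClopen_preservesOrientationAt (contMDiff_collarInclusion hc.1)
    (mfderiv_collarInclusion_injective hc.1)
  have continuous_line : Continuous fun t : Set.Icc (0 : ℝ) 1 => cylinderDiffeomorph S (x, t) :=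
    (cylinderDiffeomorph S).continuous.comp (continuous_const.prodMk continuous_id)
  exact ((hclopen.preimage continuous_line).eq_univ
    ⟨0, preservesOrientationAt_collarInclusion_inMap hc x⟩).ge (Set.mem_univ t)

lemma outMap_notMem_range_collar (hc : IsCollar N.inMap c) (y : U) :
    N.outMap y ∉ Set.range c := by
  rintro ⟨⟨x, t⟩, h⟩
  have isBoundaryPoint_collar : (x, t) ∈
      ((𝓡 d).prod (𝓡∂ 1)).boundary (S × EuclideanHalfSpace 1) :=
    ((hc.1 (x, t)).isBoundaryPoint_iff (by simp)).2 (h ▸ N.isBoundaryPoint_outMap y)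
  rw [ModelWithCorners.boundary_of_boundaryless_left] at isBoundaryPoint_collar
  have isBoundaryPoint_t : (𝓡∂ 1).IsBoundaryPoint t := isBoundaryPoint_collar.2
  rw [ModelWithCorners.isBoundaryPoint_iff,
    frontier_range_modelWithCornersEuclideanHalfSpace] at isBoundaryPoint_t
  have t_eq_zero : 0 = t := halfLineCoord_injective isBoundaryPoint_t
  rw [← t_eq_zero, hc.2.2] at h
  exact N.inMap_ne_outMap x y h

variable {s : EuclideanHalfSpace 1 → EuclideanHalfSpace 1} {R : ℝ}

lemma range_collarInclusion_union_range_collarPush {c : S × EuclideanHalfSpace 1 → W}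
    (hinj : Function.Injective c) (hs : IsHalfLineShift s R) :
    Set.range (collarInclusion c) ∪ Set.range (collarPush c s) = Set.univ := by
  refine Set.eq_univ_of_forall fun p => ?_
  by_cases hp : p ∈ Set.range c
  · obtain ⟨⟨x, t⟩, rfl⟩ := hp
    rcases le_total (halfLineCoord t) 1 with ht | ht
    · refine Or.inl ⟨cylinderDiffeomorph S (x, ⟨halfLineCoord t, halfLineCoord_nonneg t, ht⟩), ?_⟩
      exact congrArg (fun t => c (x, t)) (halfLineCoord_injective rfl)
    · obtain ⟨t', rfl⟩ := hs.range_eq.ge ht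
      exact Or.inr ⟨c (x, t'), collarPush_apply hinj _⟩
  · exact Or.inr ⟨p, collarPush_of_notMem_range hp⟩

lemma iccToHalfLine_eq_shift_iff (hs : IsHalfLineShift s R) {r : Set.Icc (0 : ℝ) 1}
    {t : EuclideanHalfSpace 1} : iccToHalfLine r = s t ↔ r = 1 ∧ t = 0 := by
  constructor
  · intro h
    have coord_eq : r.val = halfLineCoord (s t) := congrArg halfLineCoord h
    have coord_eq_one : halfLineCoord (s t) = 1 :=
      le_antisymm (coord_eq ▸ r.2.2) (hs.range_eq.le ⟨t, rfl⟩)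
    exact ⟨Subtype.ext (coord_eq.trans coord_eq_one),
      hs.injective (halfLineCoord_injective (coord_eq_one.trans hs.halfLineCoord_zero.symm))⟩
  · rintro ⟨rfl, rfl⟩
    exact halfLineCoord_injective hs.halfLineCoord_zero.symm

lemma collarInclusion_eq_collarPush_iff (hc : IsCollar N.inMap c) (hs : IsHalfLineShift s R)
    (p : (cylinder S).bulk) (q : N.bulk) : collarInclusion c p = collarPush c s q ↔
      ∃ x, p = (cylinder S).outMap x ∧ q = N.inMap x := by
  constructor
  · intro h
    obtain ⟨⟨y, t⟩, rfl⟩ : q ∈ Set.range c :=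
      (collarPush_mem_range_iff (s := s) hc.2.1).1 (h ▸ Set.mem_range_self _)
    obtain ⟨⟨x, r⟩, rfl⟩ := (cylinderDiffeomorph S).surjective p
    have shifted : c (x, iccToHalfLine r) = c (y, s t) := h.trans (collarPush_apply hc.2.1 _)
    obtain ⟨rfl, hrt⟩ := Prod.mk.inj (hc.2.1 shifted)
    obtain ⟨rfl, rfl⟩ := (iccToHalfLine_eq_shift_iff hs).1 hrt
    exact ⟨x, rfl, hc.2.2 x⟩
  · rintro ⟨x, rfl, rfl⟩
    rw [← hc.2.2 x, collarPush_apply hc.2.1]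
    exact congrArg (fun t => c (x, t)) ((iccToHalfLine_eq_shift_iff hs).2 ⟨rfl, rfl⟩)

lemma isCollar_cylinder_outMap : IsCollar (cylinder S).outMap
    (fun p : S × EuclideanHalfSpace 1 => cylinderDiffeomorph S (p.1, halfLineToIcc p.2)) := by
  refine ⟨fun p => (isLocalDiffeomorph_halfLineToIcc p).comp (𝓡∂ (d + 1)) (cylinder S).bulk
    ((cylinderDiffeomorph S).isLocalDiffeomorph _), fun p q h => ?_,
    fun x => congrArg (fun t => cylinderDiffeomorph S (x, t)) halfLineToIcc_zero⟩
  obtain ⟨hfst, hsnd⟩ := Prod.mk.inj ((cylinderDiffeomorph S).injective h)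
  exact Prod.ext hfst (halfLineToIcc_injective hsnd)

lemma IsCollar.shrink {φ : S → W} {c : S × EuclideanHalfSpace 1 → W} (hc : IsCollar φ c) :
    IsCollar φ fun p => c (p.1, shrinkHalfLine p.2) := by
  refine ⟨fun p => (isLocalDiffeomorph_shrinkHalfLine p).comp (𝓡∂ (d + 1)) W (hc.1 _),
    fun p q h => ?_,
    fun x => (congrArg (fun t => c (x, t)) shrinkHalfLine_zero).trans (hc.2.2 x)⟩
  obtain ⟨hfst, hsnd⟩ := Prod.mk.inj (hc.2.1 h)
  exact Prod.ext hfst (shrinkHalfLine_injective hsnd)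

theorem cylinder_isGluing (hc : IsCollar N.inMap c) :
    (cylinder S).IsGluing (fun x => x) N N := by
  obtain ⟨s, R, hs⟩ := exists_isHalfLineShift
  refine ⟨collarInclusion c, collarPush c s, orientationPreserving_collarInclusion hc,
    orientationPreserving_collarPush hc.1 hc.2.1 hs, collarInclusion_injective hc.2.1,
    collarPush_injective hc.2.1 hs, range_collarInclusion_union_range_collarPush hc.2.1 hs,
    collarInclusion_eq_collarPush_iff hc hs, collarInclusion_inMap hc,
    fun y => collarPush_of_notMem_range (outMap_notMem_range_collar hc y),
    _, _, fun p => c (p.1, lineToHalfLine p.2), isCollar_cylinder_outMap, hc.shrink,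
    fun p => (isLocalDiffeomorph_lineToHalfLine p).comp (𝓡∂ (d + 1)) N.bulk (hc.1 _),
    fun x t => ⟨?_, ?_⟩⟩
  · refine congrArg (fun t => c (x, t)) (halfLineCoord_injective ?_)
    change 1 + squash (-halfLineCoord t) = 1 - squash (halfLineCoord t)
    rw [squash_neg, sub_eq_add_neg]
  · rw [collarPush_apply hc.2.1]
    refine congrArg (fun t => c (x, t)) (halfLineCoord_injective ?_)
    exact (hs.halfLineCoord_eq_one_add (shrinkHalfLine t) (abs_lt.1 (abs_squash_lt _)).2.le).symm

end CylinderGluing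

/-! ### Reparametrizing the in-boundary of a cobordism -/

section Precomp

variable {d : ℕ} {S T U : ClosedManifold d}

/-- The cobordism `M` with its in-boundary reparametrized by `f`. Gluing along `f` is composing with
`N.precomp f`, and `F.map (N.precomp f)` differs from `F.map N` by the mapping cylinder of `f`. -/
def Cobordism.precomp (M : Cobordism S T) (f : Diffeomorph (𝓡 d) (𝓡 d) S S ∞)
    (hf : OrientationPreserving S S f) : Cobordism S T where
  bulk := M.bulk
  inMap x := M.inMap (f x)
  outMap := M.outMap
  contMDiff_inMap := M.contMDiff_inMap.comp f.contMDiff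
  contMDiff_outMap := M.contMDiff_outMap
  injective_inMap := M.injective_inMap.comp f.injective
  injective_outMap := M.injective_outMap
  inMap_ne_outMap x y := M.inMap_ne_outMap (f x) y
  boundary_eq := by
    rw [M.boundary_eq]
    exact congrArg (· ∪ _) (f.surjective.range_comp M.inMap).symm
  orient_inMap x v w hv := by
    have chain_rule : mfderiv (𝓡 d) (𝓡∂ (d + 1)) (fun x => M.inMap (f x)) x =
        (mfderiv (𝓡 d) (𝓡∂ (d + 1)) M.inMap (f x)).comp (mfderiv (𝓡 d) (𝓡 d) f x) :=
      mfderiv_comp x (M.contMDiff_inMap.mdifferentiableAt (by simp))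
        (f.contMDiff.mdifferentiableAt (by simp))
    rw [chain_rule]
    exact (M.orient_inMap (f x) v (fun i => mfderiv (𝓡 d) (𝓡 d) f x (w i)) hv).trans (hf.2 x w)
  orient_outMap := M.orient_outMap

lemma Cobordism.IsGluing.precomp {M : Cobordism S T} {N : Cobordism T U} {W : Cobordism S U}
    (h : M.IsGluing (fun x => x) N W) (f : Diffeomorph (𝓡 d) (𝓡 d) S S ∞)
    (hf : OrientationPreserving S S f) :
    (M.precomp f hf).IsGluing (fun x => x) N (W.precomp f hf) := by
  obtain ⟨i, j, hi, hj, hi_inj, hj_inj, hcover, hglue, hin, hout, hcollar⟩ := h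
  exact ⟨i, j, hi, hj, hi_inj, hj_inj, hcover, hglue, fun x => hin (f x), hout, hcollar⟩

lemma IsCollar.of_comp {W : ManifoldWithBoundary d} {φ : S → W}
    {c : S × EuclideanHalfSpace 1 → W} (f : Diffeomorph (𝓡 d) (𝓡 d) S S ∞)
    (hc : IsCollar (fun x => φ (f x)) c) :
    IsCollar φ (c ∘ f.symm.prodCongr (Diffeomorph.refl (𝓡∂ 1) (EuclideanHalfSpace 1) ∞)) := by
  let e := f.symm.prodCongr (Diffeomorph.refl (𝓡∂ 1) (EuclideanHalfSpace 1) ∞)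
  exact ⟨fun p => (e.isLocalDiffeomorph p).comp (𝓡∂ (d + 1)) W (hc.1 _),
    hc.2.1.comp e.injective,
    fun x => (hc.2.2 (f.symm x)).trans (congrArg φ (f.apply_symm_apply x))⟩

end Precomp

/-! ### Cobordisms between empty manifolds -/

section Empty

variable {d : ℕ}

instance CompactOriented.isEmpty_sum {n : ℕ} {H : Type} [TopologicalSpace H]
    {I : ModelWithCorners ℝ (EuclideanSpace ℝ (Fin n)) H} {M N : CompactOriented I} [IsEmpty M]
    [IsEmpty N] : IsEmpty (M.sum N) :=
  inferInstanceAs (IsEmpty (M ⊕ N))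

/-- The closed manifold `X` as a cobordism from `S` to `T`, for arbitrary empty `S` and `T`: unlike
in `X.toCobordism`, these may be disjoint unions of empty manifolds. -/
def ClosedBulk.cobordismOfIsEmpty (X : ClosedBulk d) (S T : ClosedManifold d) [IsEmpty S]
    [IsEmpty T] : Cobordism S T where
  bulk := X.1
  inMap := isEmptyElim
  outMap := isEmptyElim
  contMDiff_inMap x := isEmptyElim x
  contMDiff_outMap x := isEmptyElim x
  injective_inMap x := isEmptyElim x
  injective_outMap x := isEmptyElim x
  inMap_ne_outMap x := isEmptyElim x
  boundary_eq := by rw [X.2, Set.range_eq_empty, Set.range_eq_empty, Set.union_empty]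
  orient_inMap x := isEmptyElim x
  orient_outMap x := isEmptyElim x

lemma isGluing_of_isEmpty {S T T' U : ClosedManifold d} [IsEmpty S] [IsEmpty T] [IsEmpty T']
    [IsEmpty U] {M : Cobordism S T} (f : T → T') {N : Cobordism T' U} {W : Cobordism S U}
    (h : OrientedDiffeomorphic (M.bulk.sum N.bulk) W.bulk) : M.IsGluing f N W := by
  obtain ⟨e, he⟩ := h
  refine ⟨fun p => e (Sum.inl p), fun q => e (Sum.inr q),
    he.comp (OrientationPreserving.inl _ _), he.comp (OrientationPreserving.inr _ _),
    e.injective.comp Sum.inl_injective, e.injective.comp Sum.inr_injective, ?_, fun p q => ?_,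
    fun x => isEmptyElim x, fun x => isEmptyElim x, fun p => isEmptyElim p.1,
    fun p => isEmptyElim p.1, fun p => isEmptyElim p.1,
    ⟨fun p => isEmptyElim p.1, fun p => isEmptyElim p.1, fun x => isEmptyElim x⟩,
    ⟨fun p => isEmptyElim p.1, fun p => isEmptyElim p.1, fun x => isEmptyElim x⟩,
    fun p => isEmptyElim p.1, fun x => isEmptyElim x⟩
  · refine Set.eq_univ_of_forall fun p => ?_
    obtain ⟨q, rfl⟩ := e.surjective p
    rcases q with q | q
    · exact Or.inl ⟨q, rfl⟩
    · exact Or.inr ⟨q, rfl⟩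
  · exact ⟨fun h => absurd (e.injective h) Sum.inl_ne_inr, fun ⟨x, _⟩ => isEmptyElim x⟩

lemma isMappingCylinder_of_isEmpty {S T : ClosedManifold d} [IsEmpty S] [IsEmpty T] (f : S → T)
    (C : Cobordism S T) [IsEmpty C.bulk] : C.IsMappingCylinder f :=
  ⟨{  toFun := fun p => isEmptyElim p.1
      invFun := fun p => isEmptyElim p
      left_inv := fun p => isEmptyElim p.1
      right_inv := fun p => isEmptyElim p
      contMDiff_toFun := fun p => isEmptyElim p.1
      contMDiff_invFun := fun p => isEmptyElim p },
    fun x => isEmptyElim x, fun x => isEmptyElim x⟩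

end Empty

/-! ### The values of a TQFT on closed manifolds -/

section ClosedValue

variable {k : Type u} [Field k] {d : ℕ}

namespace TQFT

lemma unit_eq_smul (F : TQFT k d) (r : k) : F.unit r = r • F.unit 1 := by
  rw [← map_smul, smul_eq_mul, mul_one]

lemma map_toCobordism_unit (F : TQFT k d) (X : ClosedBulk d) :
    F.map X.toCobordism (F.unit 1) = F.closedValue X • F.unit 1 := by
  rw [← F.unit_eq_smul, closedValue, LinearEquiv.apply_symm_apply]

lemma closedValue_congr (F : TQFT k d) {X Y : ClosedBulk d}
    (h : OrientedDiffeomorphic X.1 Y.1) : F.closedValue X = F.closedValue Y := by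
  obtain ⟨f, hf⟩ := h
  unfold closedValue
  rw [F.map_equivalent X.toCobordism Y.toCobordism
    ⟨f, hf, fun x => isEmptyElim x, fun x => isEmptyElim x⟩]

lemma Iso.closedValue_eq {F G : TQFT k d} (e : F.Iso G) (X : ClosedBulk d) :
    F.closedValue X = G.closedValue X := by
  have unit_symm_app : ∀ a, G.unit.symm (e.app _ a) = F.unit.symm a := fun a => by
    obtain ⟨r, rfl⟩ := F.unit.surjective a
    rw [F.unit_eq_smul, map_smul, map_smul, map_smul, e.app_unit, LinearEquiv.symm_apply_apply,
      LinearEquiv.symm_apply_apply]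
  rw [closedValue, closedValue, ← unit_symm_app, e.naturality, e.app_unit]

lemma mul_unit_one (F G : TQFT k d) : (F.mul G).unit 1 = F.unit 1 ⊗ₜ[k] G.unit 1 := by
  change TensorProduct.congr F.unit G.unit ((TensorProduct.lid k k).symm 1) = _
  simp

lemma closedValue_mul (F G : TQFT k d) (X : ClosedBulk d) :
    (F.mul G).closedValue X = F.closedValue X * G.closedValue X := by
  have map_unit : (F.mul G).map X.toCobordism ((F.mul G).unit 1) =
      (F.closedValue X * G.closedValue X) • (F.mul G).unit 1 := by
    rw [mul_unit_one]
    refine (TensorProduct.map_tmul (F.map X.toCobordism) (G.map X.toCobordism) _ _).trans ?_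
    rw [map_toCobordism_unit, map_toCobordism_unit, TensorProduct.smul_tmul_smul]
    rfl
  rw [closedValue, map_unit, map_smul, LinearEquiv.symm_apply_apply, smul_eq_mul, mul_one]

lemma closedValue_sum (F : TQFT k d) (X Y : ClosedBulk d) :
    F.closedValue (X.sum Y) = F.closedValue X * F.closedValue Y := by
  let O := CompactOriented.empty (𝓡 d)
  let C : Cobordism (O.sum O) O := ClosedBulk.empty.cobordismOfIsEmpty (O.sum O) O
  let W : Cobordism (O.sum O) O := (X.sum Y).cobordismOfIsEmpty (O.sum O) O
  have hC : IsEmpty C.bulk := inferInstanceAs (IsEmpty (CompactOriented.empty _))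
  have map_W : F.map W = F.map C ∘ₗ F.map (X.toCobordism.sum Y.toCobordism) := F.map_gluing _ _ _
    (isGluing_of_isEmpty _ (OrientedDiffeomorphic.sum_empty _))
  have map_W' : F.map W = F.map (X.sum Y).toCobordism ∘ₗ F.map C := F.map_gluing _ _ _
    (isGluing_of_isEmpty _ ((OrientedDiffeomorphic.sum_comm _ _).trans
      (OrientedDiffeomorphic.sum_empty _)))
  have map_C : ∀ a, F.map C (F.tensor O O (F.unit 1 ⊗ₜ a)) = a :=
    F.unit_tensor C (isMappingCylinder_of_isEmpty _ C)
  have values :=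
    LinearMap.congr_fun (map_W'.symm.trans map_W) (F.tensor O O (F.unit 1 ⊗ₜ F.unit 1))
  rw [LinearMap.comp_apply, LinearMap.comp_apply, map_C, F.map_sum, map_toCobordism_unit,
    map_toCobordism_unit, map_toCobordism_unit, TensorProduct.smul_tmul_smul, map_smul, map_smul,
    map_C, ← F.unit_eq_smul, ← F.unit_eq_smul] at values
  exact F.unit.injective values

lemma isTrivialOnClosed_iff (F : TQFT k d) :
    F.IsTrivialOnClosed ↔ ∀ X : ClosedBulk d, F.closedValue X = 1 := by
  constructor
  · intro h X
    rw [closedValue, h X.toCobordism, LinearMap.id_apply, LinearEquiv.symm_apply_apply]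
  · intro h M
    have hM : (𝓡∂ (d + 1)).boundary M.bulk = ∅ := by
      rw [M.boundary_eq, Set.range_eq_empty, Set.range_eq_empty, Set.union_empty]
    let X : ClosedBulk d := ⟨M.bulk, hM⟩
    have map_M : F.map M = F.map X.toCobordism := F.map_equivalent _ _
      ⟨Diffeomorph.refl _ _ _, OrientationPreserving.id _, fun x => isEmptyElim x,
        fun x => isEmptyElim x⟩
    ext a
    obtain ⟨r, rfl⟩ := F.unit.surjective a
    rw [map_M, F.unit_eq_smul, map_smul, map_toCobordism_unit, h, one_smul, LinearMap.id_apply]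

lemma exists_smul_of_iso {F G : TQFT k d} (e : (F.mul G).Iso (TQFT.trivial k d))
    {S : ClosedManifold d} (A : F.obj S →ₗ[k] F.obj S) : ∃ r : k, ∀ a, A a = r • a := by
  have := Module.Invertible.left (show F.obj S ⊗[k] G.obj S ≃ₗ[k] k from e.app S)
  obtain ⟨v, -, hv⟩ := finrank_eq_one_iff'.1 (Module.Invertible.finrank_eq_one k (F.obj S))
  obtain ⟨r, hr⟩ := hv (A v)
  refine ⟨r, fun a => ?_⟩
  obtain ⟨c, rfl⟩ := hv a
  rw [map_smul, ← hr, smul_comm]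

lemma closedValue_of_isClosedGluing (F : TQFT k d) {S : ClosedManifold d}
    {X₁ : Cobordism (.empty (𝓡 d)) S} {f : Diffeomorph (𝓡 d) (𝓡 d) S S ∞}
    (hf : OrientationPreserving S S f) {X₂ : Cobordism S (.empty (𝓡 d))} {M : ClosedBulk d}
    (h : IsClosedGluing X₁ f X₂ M) {r : k}
    (hr : ∀ a, F.map ((cylinder S).precomp f hf) a = r • a) :
    F.closedValue M = r * F.unit.symm (F.map X₂ (F.map X₁ (F.unit 1))) := by
  have gluing_M : X₁.IsGluing (fun x => x) (X₂.precomp f hf) M.toCobordism := h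
  obtain ⟨-, -, -, -, -, -, -, -, -, -, -, _, -, -, hcollar, -⟩ := h
  have gluing_precomp : ((cylinder S).precomp f hf).IsGluing (fun x => x) X₂ (X₂.precomp f hf) :=
    (cylinder_isGluing (IsCollar.of_comp f hcollar)).precomp f hf
  rw [closedValue, F.map_gluing _ _ _ gluing_M, F.map_gluing _ _ _ gluing_precomp,
    LinearMap.comp_apply, LinearMap.comp_apply, hr, map_smul, map_smul, smul_eq_mul]

lemma closedValue_mul_eq_of_isClosedGluing {F G : TQFT k d}
    (e : (F.mul G).Iso (TQFT.trivial k d)) {S : ClosedManifold d}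
    {X₁ Y₁ : Cobordism (.empty (𝓡 d)) S} {X₂ Y₂ : Cobordism S (.empty (𝓡 d))}
    {f g : Diffeomorph (𝓡 d) (𝓡 d) S S ∞} {M N M' N' : ClosedBulk d}
    (hf : OrientationPreserving S S f) (hg : OrientationPreserving S S g)
    (hM : IsClosedGluing X₁ f X₂ M) (hN : IsClosedGluing X₁ g X₂ N)
    (hM' : IsClosedGluing Y₁ f Y₂ M') (hN' : IsClosedGluing Y₁ g Y₂ N') :
    F.closedValue M * F.closedValue N' = F.closedValue N * F.closedValue M' := by
  obtain ⟨r, hr⟩ := exists_smul_of_iso e (F.map ((cylinder S).precomp f hf))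
  obtain ⟨s, hs⟩ := exists_smul_of_iso e (F.map ((cylinder S).precomp g hg))
  rw [F.closedValue_of_isClosedGluing hf hM hr, F.closedValue_of_isClosedGluing hg hN hs,
    F.closedValue_of_isClosedGluing hf hM' hr, F.closedValue_of_isClosedGluing hg hN' hs]
  ring

end TQFT

end ClosedValue

/-! ### The homomorphism `Ψ` -/

section Psi

variable {k : Type u} [Field k] {d : ℕ}

lemma SKK.hom_ext {A : Type*} [AddCommGroup A] {φ ψ : SKK d →+ A}
    (h : ∀ X : ClosedBulk d, φ X.toSKK = ψ X.toSKK) : φ = ψ := by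
  refine QuotientAddGroup.addMonoidHom_ext _ ?_
  refine Algebra.GrothendieckAddGroup.lift.symm.injective ?_
  ext x
  obtain ⟨X, rfl⟩ := Quotient.exists_rep x
  exact h X

variable (k d) in
/-- The values of TQFTs on all closed manifolds, as a homomorphism on the monoid of isomorphism
classes of TQFTs under tensor product. -/
def closedValueHom : TQFTClass k d →* (ClosedBulk d → k) where
  toFun := Quotient.lift (fun F X => F.closedValue X) fun _ _ ⟨e⟩ => funext e.closedValue_eq
  map_one' := rfl
  map_mul' := by
    rintro ⟨F⟩ ⟨G⟩
    exact funext (TQFT.closedValue_mul F G)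

/-- The value of invertible TQFTs on the closed manifold `X`, which is a unit of `k`. -/
def unitValue (X : ClosedBulk d) : InvertibleTQFTGroup k d →* kˣ :=
  Units.map ((Pi.evalMonoidHom (fun _ : ClosedBulk d => k) X).comp (closedValueHom k d))

lemma unitValue_eq {u : InvertibleTQFTGroup k d} {F : TQFT k d} (h : F.toClass = u)
    (X : ClosedBulk d) : (unitValue X u : k) = F.closedValue X := by
  change closedValueHom k d u X = _
  rw [← h]
  rfl

lemma exists_iso_trivial {u : InvertibleTQFTGroup k d} {F : TQFT k d} (h : F.toClass = u) :
    ∃ G : TQFT k d, Nonempty ((F.mul G).Iso (TQFT.trivial k d)) := by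
  obtain ⟨G, hG⟩ := Quotient.exists_rep (↑u⁻¹ : TQFTClass k d)
  refine ⟨G, Quotient.exact (s := TQFT.setoid) ?_⟩
  change F.toClass * G.toClass = 1
  rw [h, show G.toClass = (↑u⁻¹ : TQFTClass k d) from hG, Units.mul_inv]

lemma exists_toClass_eq (u : InvertibleTQFTGroup k d) : ∃ F : TQFT k d, F.toClass = u :=
  Quotient.exists_rep (u : TQFTClass k d)

lemma unitValue_sum (u : InvertibleTQFTGroup k d) (X Y : ClosedBulk d) :
    unitValue (X.sum Y) u = unitValue X u * unitValue Y u := by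
  obtain ⟨F, hF⟩ := exists_toClass_eq u
  refine Units.ext ?_
  rw [Units.val_mul, unitValue_eq hF, unitValue_eq hF, unitValue_eq hF, F.closedValue_sum]

lemma unitValue_congr (u : InvertibleTQFTGroup k d) {X Y : ClosedBulk d}
    (h : OrientedDiffeomorphic X.1 Y.1) : unitValue X u = unitValue Y u := by
  obtain ⟨F, hF⟩ := exists_toClass_eq u
  refine Units.ext ?_
  rw [unitValue_eq hF, unitValue_eq hF, F.closedValue_congr h]

lemma unitValue_empty (u : InvertibleTQFTGroup k d) : unitValue ClosedBulk.empty u = 1 := by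
  have idempotent := unitValue_sum u ClosedBulk.empty ClosedBulk.empty
  rw [unitValue_congr u (Y := ClosedBulk.empty) (OrientedDiffeomorphic.sum_empty _)] at idempotent
  exact left_eq_mul.1 idempotent

/-- The values of an invertible TQFT on closed manifolds, as a homomorphism on `𝕄_n`. -/
def manifoldClassHom (u : InvertibleTQFTGroup k d) : ManifoldClass d →+ Additive kˣ where
  toFun := Quotient.lift (fun X => Additive.ofMul (unitValue X u)) fun _ _ => unitValue_congr u
  map_zero' := unitValue_empty u
  map_add' := by
    rintro ⟨X⟩ ⟨Y⟩
    exact unitValue_sum u X Y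

/-- The extension of `manifoldClassHom u` to the Grothendieck group of `𝕄_n`. -/
def grothendieckHom (u : InvertibleTQFTGroup k d) :
    Algebra.GrothendieckAddGroup (ManifoldClass d) →+ Additive kˣ :=
  Algebra.GrothendieckAddGroup.lift (manifoldClassHom u)

lemma grothendieckHom_toGrothendieck (u : InvertibleTQFTGroup k d) (X : ClosedBulk d) :
    grothendieckHom u X.toGrothendieck = Additive.ofMul (unitValue X u) :=
  DFunLike.congr_fun (Algebra.GrothendieckAddGroup.lift.symm_apply_apply (manifoldClassHom u)) _

lemma relationsSKK_le_ker (u : InvertibleTQFTGroup k d) :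
    relationsSKK d ≤ (grothendieckHom u).ker := by
  refine (AddSubgroup.closure_le _).2 ?_
  rintro _ ⟨S, X₁, Y₁, X₂, Y₂, f, g, M, N, M', N', hf, hg, hM, hN, hM', hN', rfl⟩
  obtain ⟨F, hF⟩ := exists_toClass_eq u
  obtain ⟨G, ⟨e⟩⟩ := exists_iso_trivial hF
  have unitValue_mul_eq : unitValue M u * unitValue N' u = unitValue N u * unitValue M' u := by
    refine Units.ext ?_
    rw [Units.val_mul, Units.val_mul, unitValue_eq hF, unitValue_eq hF, unitValue_eq hF,
      unitValue_eq hF, TQFT.closedValue_mul_eq_of_isClosedGluing e hf hg hM hN hM' hN']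
  change grothendieckHom u _ = 0
  rw [map_add, map_sub, map_sub, grothendieckHom_toGrothendieck, grothendieckHom_toGrothendieck,
    grothendieckHom_toGrothendieck, grothendieckHom_toGrothendieck, sub_sub, sub_add_eq_add_sub,
    sub_eq_zero, ← ofMul_mul, ← ofMul_mul, unitValue_mul_eq]

/-- The homomorphism on `SKK_n` induced by `grothendieckHom u`. -/
def skkHom (u : InvertibleTQFTGroup k d) : SKK d →+ Additive kˣ :=
  QuotientAddGroup.lift _ (grothendieckHom u) (relationsSKK_le_ker u)

lemma skkHom_toSKK (u : InvertibleTQFTGroup k d) (X : ClosedBulk d) :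
    skkHom u X.toSKK = Additive.ofMul (unitValue X u) :=
  grothendieckHom_toGrothendieck u X

lemma multiplicative_SKK_hom_ext {φ ψ : Multiplicative (SKK d) →* kˣ}
    (h : ∀ X : ClosedBulk d,
      φ (Multiplicative.ofAdd X.toSKK) = ψ (Multiplicative.ofAdd X.toSKK)) : φ = ψ :=
  AddMonoidHom.toMultiplicativeLeft.symm.injective (SKK.hom_ext h)

variable (k d) in
/-- The homomorphism `Ψ_n`, with `SKK_n` written multiplicatively. -/
def psi : InvertibleTQFTGroup k d →* (Multiplicative (SKK d) →* kˣ) where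
  toFun u := AddMonoidHom.toMultiplicativeLeft (skkHom u)
  map_one' := multiplicative_SKK_hom_ext fun X =>
    (congrArg Additive.toMul (skkHom_toSKK 1 X)).trans (map_one (unitValue X))
  map_mul' u v := multiplicative_SKK_hom_ext fun X =>
    (congrArg Additive.toMul (skkHom_toSKK (u * v) X)).trans <|
      (map_mul (unitValue X) u v).trans <|
        congrArg₂ (· * ·) (congrArg Additive.toMul (skkHom_toSKK u X)).symm
          (congrArg Additive.toMul (skkHom_toSKK v X)).symm

variable (k d) in
lemma isPsi_psi : IsPsi (psi k d) := fun u F h X => by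
  rw [← unitValue_eq h]
  exact congrArg (fun z => ((Additive.toMul z : kˣ) : k)) (skkHom_toSKK u X)

lemma IsPsi.eq {Ψ Ψ' : InvertibleTQFTGroup k d →* (Multiplicative (SKK d) →* kˣ)}
    (h : IsPsi Ψ) (h' : IsPsi Ψ') : Ψ = Ψ' := by
  refine MonoidHom.ext fun u => multiplicative_SKK_hom_ext fun X => Units.ext ?_
  obtain ⟨F, hF⟩ := exists_toClass_eq u
  rw [h u F hF X, h' u F hF X]

lemma IsPsi.trivialOnClosed_eq_ker
    {Ψ : InvertibleTQFTGroup k d →* (Multiplicative (SKK d) →* kˣ)} (h : IsPsi Ψ) :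
    trivialOnClosed k d = Ψ.ker := by
  ext u
  rw [MonoidHom.mem_ker]
  constructor
  · intro hu
    refine multiplicative_SKK_hom_ext fun X => Units.ext ?_
    obtain ⟨F, hF⟩ := exists_toClass_eq u
    rw [h u F hF X]
    exact F.isTrivialOnClosed_iff.1 (hu F hF) X
  · intro hu F hF
    refine F.isTrivialOnClosed_iff.2 fun X => ?_
    rw [← h u F hF X, hu]
    rfl

end Psi

end
end InvertibleTQFT

theorem mainTheorem2 (k : Type u) [Field k] (d : ℕ) :
    (∃! Ψ : InvertibleTQFT.InvertibleTQFTGroup k d →*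
        (Multiplicative (InvertibleTQFT.SKK d) →* kˣ), InvertibleTQFT.IsPsi Ψ) ∧
      ∀ Ψ : InvertibleTQFT.InvertibleTQFTGroup k d →*
        (Multiplicative (InvertibleTQFT.SKK d) →* kˣ), InvertibleTQFT.IsPsi Ψ →
          InvertibleTQFT.trivialOnClosed k d = Ψ.ker :=
  ⟨⟨InvertibleTQFT.psi k d, InvertibleTQFT.isPsi_psi k d,
    fun _ h => h.eq (InvertibleTQFT.isPsi_psi k d)⟩, fun _ h => h.trivialOnClosed_eq_ker⟩
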